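/- Let $p\ge 1$ be an integer and $0<\delta<\pi$. Define $g_p:\mathbb R\to\mathbb R$ (depending on $\delta$) as follows. At level $0$ take, on the window $I=[\pi-\delta,\pi+\delta]$, one rectangle of signed height $-1/\delta$. Given the level-$q$ function, which is piecewise constant on the $2^q$ equal pieces of $I$, let $\tau_q$ be obtained by replacing the rectangle of signed height $h$ on each piece by the isosceles triangle on the same base with the same signed area (so with peak $2h$), by $0$ on the rest of the period, and by $2\pi$-periodicity; the level-$(q+1)$ function is the derivative of $\tau_q$ on $I$, which is piecewise constant on the $2^{q+1}$ equal pieces of $I$. Put $$g_p(x)=\int_0^x\Big(\frac1\pi+\underbrace{\int_0\cdots\int_0}_{p-1}\tau_{p-1}\Big)\,dt ,$$ where the inner expression is the $(p-1)$-fold iterated integral from $0$ of $\tau_{p-1}$. **Theorem.** There are absolute constants $C>0$ and $k\in\mathbb N$ such that, for all such $p$ and $\delta$: 1. $g_p$ is $2\pi$-periodic and of class $C^p$, $g_p(x)=x/\pi$ for $x\in(-\pi+\delta,\pi-\delta)$, and $g_p^{(p)}$ is Lipschitz with constant $\sqrt2^{\,p(p+1)}/\delta^{p+1}$. The function $\bar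 g_p(z)=g_p(\arg z)$ on the unit circle satisfies $\bar g_p(e^{ix})=g_p(x)$ for all real $x$. 2. For every $\varepsilon>0$ there are an integer $d\ge0$ and a complex Laurent polynomial $P(z)=\sum_{|n|\le d}c_nz^n$ with $|P(z)-\bar g_p(z)|\le\varepsilon$ for all $|z|=1$ and $$d\le C\,X\,(1+\log(1+X))^k,\qquad X=\frac{\sqrt2^{\,p}}{\delta}\Big(\frac1\varepsilon\Big)^{\frac1{p+1}} .$$ Moreover, the same $d$ satisfies this bound with $X$ replaced by $\frac{A_p\sqrt2^{\,p}}{\delta}\big(\frac1\varepsilon\big)^{1/(p+1)}$, that is, $d=\tilde O\big(\frac{A_p\sqrt2^{\,p}}{\delta}\varepsilon^{-1/(p+1)}\big)$, for every real number $A_p$ that is admissible in Jackson's inequality: for every $C^p$, $2\pi$-periodic $f:\mathbb R\to\mathbb R$ whose $p$-th derivative is $K$-Lipschitz, the Fourier sums $S_df$ satisfy $\|S_df-f\|_\infty\le K A_p\log d/d^{p+1}$ for all $d\ge2$. -/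

import Mathlib

namespace PhaseExtraction

noncomputable section

/-- The window `(π - δ, π + δ)` is cut into `2 ^ q` equal pieces; `pieceSign q j` is the sign of the
`j`-th rectangle at level `q` (`j < 2 ^ q`).  There is one downward rectangle at level `0`.  When a
rectangle is replaced by a triangle, the two sides of the triangle have slopes of opposite signs, the
first one having the sign of the rectangle; these slopes are the two rectangles of the next level. -/
def pieceSign : ℕ → ℕ → ℝ
  | 0, _ => -1
  | q + 1, j => if j % 2 = 0 then pieceSign q (j / 2) else -pieceSign q (j / 2)

/-- The absolute height of the rectangles at level `q`.  At level `0` the single rectangle, of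
width `2 * δ`, has area `2`.  A rectangle of height `h` on a piece of length `2 * δ / 2 ^ q` is replaced
by the triangle of the same area, of height `2 * h`, whose sides have slope
`2 * h / (δ / 2 ^ q)`; this slope is the next height. -/
def rectHeight (δ : ℝ) : ℕ → ℝ
  | 0 => 1 / δ
  | q + 1 => 2 * rectHeight δ q / (δ / 2 ^ q)

/-- The `2π`-periodic continuous function made of the `2 ^ q` triangles that replace the rectangles of
level `q` in the window `[π - δ, π + δ]`, and equal to `0` in the rest of the period.
Here `s` is the position in the window in units of the length of one piece, so that `⌊s⌋₊` is the
number of the piece and `Int.fract s` the relative position in that piece. -/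
def triangles (δ : ℝ) (q : ℕ) (x : ℝ) : ℝ :=
  let y := toIcoMod Real.two_pi_pos 0 (x - (Real.pi - δ))
  let s := y / (2 * δ / 2 ^ q)
  if y < 2 * δ then
    2 * rectHeight δ q * pieceSign q ⌊s⌋₊ * (1 - |2 * Int.fract s - 1|)
  else 0

/-- The `n`-fold iterated integral from `0`. -/
def iterInt : ℕ → (ℝ → ℝ) → ℝ → ℝ
  | 0, f => f
  | n + 1, f => fun x => ∫ t in (0 : ℝ)..x, iterInt n f t

/-- The function `g_p` (for `p ≥ 1`):
`g_p(x) = ∫₀ˣ (1/π + ∫₀ ⋯ ∫₀ (triangles))` with `p - 1` inner integrals.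
So its `p`-th derivative is made of `2 ^ (p - 1)` triangles (plus the constant `1 / π` when `p = 1`). -/
def phaseFun (δ : ℝ) (p : ℕ) (x : ℝ) : ℝ :=
  ∫ t in (0 : ℝ)..x, (1 / Real.pi + iterInt (p - 1) (triangles δ (p - 1)) t)

/-- The function `z ↦ g_p(arg z)` on the unit circle. -/
def circleFun (δ : ℝ) (p : ℕ) (z : Circle) : ℝ :=
  phaseFun δ p (Complex.arg (z : ℂ))

/-- The value at a point of the unit circle of a complex Laurent polynomial. -/
def laurentEval (P : LaurentPolynomial ℂ) (z : Circle) : ℂ :=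
  LaurentPolynomial.eval₂ (RingHom.id ℂ) (Circle.toUnits z) P

/-- A Laurent polynomial has degree at most `d` if only the powers `z ^ n` with `|n| ≤ d` occur. -/
def LaurentDegreeLE (P : LaurentPolynomial ℂ) (d : ℕ) : Prop :=
  ∀ n : ℤ, n < -(d : ℤ) ∨ (d : ℤ) < n → P.coeff n = 0

/-- The `n`-th Fourier coefficient of a `2π`-periodic function. -/
def fourierCoefficient (f : ℝ → ℝ) (n : ℤ) : ℂ :=
  (1 / (2 * Real.pi) : ℂ) *
    ∫ t in (-Real.pi)..Real.pi, (f t : ℂ) * Complex.exp (-(Complex.I * n * t))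

/-- The Fourier sum of degree `d`. -/
def fourierSum (f : ℝ → ℝ) (d : ℕ) (x : ℝ) : ℂ :=
  ∑ n ∈ Finset.Icc (-(d : ℤ)) d, fourierCoefficient f n * Complex.exp (Complex.I * n * x)

/-- `A` is an admissible constant `A_p` in Jackson's theorem on Fourier sums: if `f` is `2π`-periodic
with a `K`-Lipschitz `p`-th derivative, then `‖S_d f - f‖ ≤ K * A * log d / d ^ (p + 1)`
for all `d ≥ 2`. -/
def IsJacksonConstant (p : ℕ) (A : ℝ) : Prop :=
  ∀ (f : ℝ → ℝ) (K : ℝ), Function.Periodic f (2 * Real.pi) → ContDiff ℝ p f →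
    (∀ x y : ℝ, |iteratedDeriv p f x - iteratedDeriv p f y| ≤ K * |x - y|) →
    ∀ d : ℕ, 2 ≤ d → ∀ x : ℝ,
      ‖fourierSum f d x - (f x : ℂ)‖ ≤ K * (A * Real.log d / (d : ℝ) ^ (p + 1))

/-- `X` up to the constant `C` and a polylogarithmic factor of exponent `k`: a quantity that
is at most `softO C k X`, with `C` and `k` fixed, is `Õ(X)`. -/
def softO (C : ℝ) (k : ℕ) (X : ℝ) : ℝ :=
  C * X * (1 + Real.log (1 + X)) ^ k

end

end PhaseExtraction

/-!
Write `p = q + 1` and `h = rectHeight δ p = (√2 ^ p / δ) ^ (p + 1)`, let `w = 2 δ / 2 ^ q` be the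
length of a piece of the window at level `q`, and let `X = √2 ^ p / δ * (1 / ε) ^ (1 / (p + 1))`.

The signs of the triangles of level `q` form the Thue–Morse sequence, so the row of `2 ^ q`
triangles (`triangleTrain`) is built by repeatedly subtracting from a row its translate by its own
length. Integrating `q` times then amounts to convolving one triangle with the indicator functions
of intervals of lengths `w, 2 w, …, 2 ^ (q - 1) w`: the result is a nonnegative bump supported in
the window, of total area `2` after multiplication by the heights
(`iterInt_triangleTrain_profile`, `rectHeight_mul_area`). Hence `g_p' = 1 / π - bump` has mean
`0`, `g_p` is periodic with `|g_p| ≤ 2`, and `g_p = x / π` off the window. Its `p`-th derivative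
is a periodization of the row of triangles up to a constant, and so is Lipschitz with the slope
`h` of the triangles as constant (`abs_triangles_sub_le`).

For the approximation no Jackson theorem is needed, as the Fourier series of `g_p` converges
absolutely at the right rate. Each triangle contributes `O(n ^ (-2))` to the `n`-th Fourier
coefficient of the `p`-th derivative, there are `2 ^ q` of them, and `p` integrations by parts
give `|c_n| ≤ 2 ^ (p + 1) * h / (2 π |n| ^ (p + 2))` (`norm_fourierCoefficient_phaseFun_le`). The
tail beyond degree `d` is then at most `2 ^ (p + 1) * h / (d + 1) ^ (p + 1)`, which is at most `ε`
once `d + 1 ≥ 2 X` (`norm_fourierSum_phaseFun_sub_le`). The degree is `⌊2 X⌋` if `ε < 2`, and `0`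
if `ε ≥ 2`.

For the bound in terms of a Jackson constant `A`, the function `cos ((p + 2) x)` and its vanishing
Fourier sum of degree `p + 1` show that `A ≥ 1 / (e log (p + 1))`
(`IsJacksonConstant.exp_neg_one_le`). If `ε < 2`, then `X ≥ √2 ^ p / (2 π)`, so the possible loss
of a factor `log (p + 1)` is absorbed by the logarithm of `A X` (`two_mul_le_softO_jackson`).
-/

namespace PhaseExtraction

open MeasureTheory

/-! ### Rows of triangles with Thue–Morse signs -/

/-- A row of `2 ^ q` adjacent triangles of peak `±1`, each on a base of length `w`, filling
`[0, 2 ^ q * w]`, and `0` elsewhere. The second half of the row is the negative of the first, so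
the signs form the Thue–Morse sequence, starting with `+`. -/
noncomputable def triangleTrain (w : ℝ) : ℕ → ℝ → ℝ
  | 0, y => max 0 (1 - |2 * (y / w) - 1|)
  | q + 1, y => triangleTrain w q y - triangleTrain w q (y - 2 ^ q * w)

theorem triangleTrain_zero_of_le_half {w : ℝ} (hw : 0 < w) {t : ℝ} (h₀ : 0 ≤ t) (h₁ : t ≤ w / 2) :
    triangleTrain w 0 t = 2 / w * t := by
  have h2 : 0 ≤ t / w := div_nonneg h₀ hw.le
  have h3 : t / w ≤ 1 / 2 := by rw [div_le_iff₀ hw]; linarith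
  simp only [triangleTrain]
  rw [abs_of_nonpos (by linarith), max_eq_right (by linarith)]
  ring

theorem triangleTrain_zero_of_half_le {w : ℝ} (hw : 0 < w) {t : ℝ} (h₀ : w / 2 ≤ t) (h₁ : t ≤ w) :
    triangleTrain w 0 t = 2 - 2 / w * t := by
  have h2 : 1 / 2 ≤ t / w := by rw [le_div_iff₀ hw]; linarith
  have h3 : t / w ≤ 1 := by rw [div_le_iff₀ hw]; linarith
  simp only [triangleTrain]
  rw [abs_of_nonneg (by linarith), max_eq_right (by linarith)]
  ring

theorem continuous_triangleTrain (w : ℝ) (q : ℕ) : Continuous (triangleTrain w q) := by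
  induction q with
  | zero =>
    change Continuous fun y : ℝ => max 0 (1 - |2 * (y / w) - 1|)
    fun_prop
  | succ q ih =>
    exact ih.sub (ih.comp (continuous_id.sub continuous_const))

theorem triangleTrain_of_nonpos {w : ℝ} (hw : 0 < w) (q : ℕ) {y : ℝ} (hy : y ≤ 0) :
    triangleTrain w q y = 0 := by
  induction q generalizing y with
  | zero =>
    have h : y / w ≤ 0 := div_nonpos_of_nonpos_of_nonneg hy hw.le
    have := neg_le_abs (2 * (y / w) - 1)
    simp only [triangleTrain]
    exact max_eq_left (by linarith)
  | succ q ih =>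
    have : 0 < 2 ^ q * w := by positivity
    simp only [triangleTrain]
    rw [ih hy, ih (by linarith), sub_zero]

theorem triangleTrain_of_ge {w : ℝ} (hw : 0 < w) (q : ℕ) {y : ℝ} (hy : 2 ^ q * w ≤ y) :
    triangleTrain w q y = 0 := by
  induction q generalizing y with
  | zero =>
    have h : 1 ≤ y / w := by rw [le_div_iff₀ hw]; simpa using hy
    have := le_abs_self (2 * (y / w) - 1)
    simp only [triangleTrain]
    exact max_eq_left (by linarith)
  | succ q ih =>
    have : 0 < 2 ^ q * w := by positivity
    rw [pow_succ] at hy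
    simp only [triangleTrain]
    rw [ih (by linarith), ih (by linarith), sub_zero]

/-- Lipschitz bounds on two adjacent half-lines glue at the common end point. -/
theorem abs_sub_le_of_Iic_of_Ici {f : ℝ → ℝ} {K c : ℝ}
    (h₁ : ∀ x ≤ c, ∀ y ≤ c, |f x - f y| ≤ K * |x - y|)
    (h₂ : ∀ x, c ≤ x → ∀ y, c ≤ y → |f x - f y| ≤ K * |x - y|) (x y : ℝ) :
    |f x - f y| ≤ K * |x - y| := by
  wlog hxy : x ≤ y generalizing x y
  · rw [abs_sub_comm, abs_sub_comm x]
    exact this y x (le_of_not_ge hxy)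
  rcases le_total y c with hy | hy
  · exact h₁ x (hxy.trans hy) y hy
  rcases le_total c x with hx | hx
  · exact h₂ x hx y hy
  have h3 := h₁ x hx c le_rfl
  have h4 := h₂ c le_rfl y hy
  rw [abs_of_nonpos (by linarith : x - c ≤ 0)] at h3
  rw [abs_of_nonpos (by linarith : c - y ≤ 0)] at h4
  rw [abs_of_nonpos (by linarith : x - y ≤ 0)]
  have := abs_sub_le (f x) (f c) (f y)
  linarith

/-- The Lipschitz constant is the slope `2 / w` of one triangle, for any number of triangles: the
two halves of the row have disjoint interiors and vanish at the point where they meet. -/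
theorem abs_triangleTrain_sub_le {w : ℝ} (hw : 0 < w) (q : ℕ) (x y : ℝ) :
    |triangleTrain w q x - triangleTrain w q y| ≤ 2 / w * |x - y| := by
  induction q generalizing x y with
  | zero =>
    simp only [triangleTrain]
    refine (abs_max_sub_max_le_max _ _ _ _).trans ?_
    have h1 : (1 - |2 * (x / w) - 1|) - (1 - |2 * (y / w) - 1|)
        = |2 * (y / w) - 1| - |2 * (x / w) - 1| := by ring
    have h2 := abs_abs_sub_abs_le (2 * (y / w) - 1) (2 * (x / w) - 1)
    have h3 : (2 * (y / w) - 1) - (2 * (x / w) - 1) = 2 / w * (y - x) := by ring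
    rw [h3, abs_mul, abs_of_pos (by positivity : 0 < 2 / w), abs_sub_comm y x] at h2
    rw [h1, sub_self, abs_zero]
    exact max_le (by positivity) h2
  | succ q ih =>
    have hc : 0 < 2 ^ q * w := by positivity
    refine abs_sub_le_of_Iic_of_Ici (c := 2 ^ q * w) ?_ ?_ x y
    · intro x hx y hy
      simp only [triangleTrain]
      rw [triangleTrain_of_nonpos hw q (y := x - _) (by linarith),
        triangleTrain_of_nonpos hw q (y := y - _) (by linarith), sub_zero, sub_zero]
      exact ih x y
    · intro x hx y hy
      simp only [triangleTrain]
      rw [triangleTrain_of_ge hw q hx, triangleTrain_of_ge hw q hy, zero_sub, zero_sub,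
        neg_sub_neg, abs_sub_comm]
      simpa using ih (x - 2 ^ q * w) (y - 2 ^ q * w)

/-- `pieceSign` is defined by recursion on the lowest binary digit of the index; this and
`pieceSign_succ_add_two_pow` give the recursion on the highest digit, which is that of
`triangleTrain`. -/
theorem pieceSign_succ_of_lt {q j : ℕ} (hj : j < 2 ^ q) : pieceSign (q + 1) j = pieceSign q j := by
  induction q generalizing j with
  | zero =>
    obtain rfl : j = 0 := by simpa using hj
    simp [pieceSign]
  | succ q ih =>
    have : j / 2 < 2 ^ q := by rw [pow_succ] at hj; omega
    rw [pieceSign, ih this, ← pieceSign]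

theorem pieceSign_succ_add_two_pow {q j : ℕ} (hj : j < 2 ^ q) :
    pieceSign (q + 1) (j + 2 ^ q) = -pieceSign q j := by
  induction q generalizing j with
  | zero =>
    obtain rfl : j = 0 := by simpa using hj
    simp [pieceSign]
  | succ q ih =>
    have h1 : j / 2 < 2 ^ q := by rw [pow_succ] at hj; omega
    have h2 : (j + 2 ^ (q + 1)) / 2 = j / 2 + 2 ^ q := by rw [pow_succ]; omega
    have h3 : (j + 2 ^ (q + 1)) % 2 = j % 2 := by rw [pow_succ]; omega
    rw [pieceSign, h2, h3, ih h1, pieceSign]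
    split_ifs <;> rfl

theorem triangleTrain_mul_eq_pieceSign {w : ℝ} (hw : 0 < w) (q : ℕ) {s : ℝ} (hs₀ : 0 ≤ s)
    (hs : s < 2 ^ q) :
    triangleTrain w q (s * w) = -pieceSign q ⌊s⌋₊ * (1 - |2 * Int.fract s - 1|) := by
  induction q generalizing s with
  | zero =>
    have hs : s < 1 := by simpa using hs
    rw [Int.fract_eq_self.2 ⟨hs₀, hs⟩]
    simp only [triangleTrain, pieceSign, mul_div_cancel_right₀ _ hw.ne']
    rw [max_eq_right]
    · ring
    · have : |2 * s - 1| ≤ 1 := abs_le.2 ⟨by linarith, by linarith⟩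
      linarith
  | succ q ih =>
    simp only [triangleTrain]
    rcases lt_or_ge s (2 ^ q) with h | h
    · have hfl : ⌊s⌋₊ < 2 ^ q := (Nat.floor_lt hs₀).2 (by exact_mod_cast h)
      have : s * w < 2 ^ q * w := by gcongr
      rw [ih hs₀ h, triangleTrain_of_nonpos hw q (by linarith), sub_zero,
        pieceSign_succ_of_lt hfl]
    · -- In the second half of the row the index of the piece has the digit `2 ^ q`.
      obtain ⟨t, rfl⟩ : ∃ t, s = t + ((2 ^ q : ℕ) : ℝ) := ⟨s - ((2 ^ q : ℕ) : ℝ), by ring⟩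
      push_cast at h hs
      have ht₀ : 0 ≤ t := by linarith
      have ht : t < 2 ^ q := by rw [pow_succ] at hs; linarith
      have hfl : ⌊t⌋₊ < 2 ^ q := (Nat.floor_lt ht₀).2 (by exact_mod_cast ht)
      rw [Nat.floor_add_natCast ht₀, Int.fract_add_natCast, pieceSign_succ_add_two_pow hfl,
        triangleTrain_of_ge hw q (by push_cast; gcongr)]
      have : (t + ((2 ^ q : ℕ) : ℝ)) * w - 2 ^ q * w = t * w := by push_cast; ring
      rw [this, ih ht₀ ht]
      ring

/-! ### Iterated integrals from zero -/

theorem continuous_iterInt {f : ℝ → ℝ} (hf : Continuous f) (m : ℕ) : Continuous (iterInt m f) := by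
  induction m with
  | zero => exact hf
  | succ m ih =>
    exact intervalIntegral.continuous_primitive (fun a b => ih.intervalIntegrable a b) 0

theorem hasDerivAt_iterInt_succ {f : ℝ → ℝ} (hf : Continuous f) (m : ℕ) (x : ℝ) :
    HasDerivAt (iterInt (m + 1) f) (iterInt m f x) x :=
  (continuous_iterInt hf m).integral_hasStrictDerivAt 0 x |>.hasDerivAt

theorem iterInt_congr {f g : ℝ → ℝ} (m : ℕ) {x : ℝ} (h : ∀ t ∈ Set.uIcc 0 x, f t = g t) :
    iterInt m f x = iterInt m g x := by
  induction m generalizing x with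
  | zero => exact h x Set.right_mem_uIcc
  | succ m ih =>
    exact intervalIntegral.integral_congr fun t ht =>
      ih fun s hs => h s (Set.uIcc_subset_uIcc Set.left_mem_uIcc ht hs)

theorem iterInt_zero_fun (m : ℕ) (x : ℝ) : iterInt m (fun _ => 0) x = 0 := by
  induction m generalizing x with
  | zero => rfl
  | succ m ih => simp [iterInt, ih]

theorem iterInt_eq_zero {f : ℝ → ℝ} (m : ℕ) {x : ℝ} (h : ∀ t ∈ Set.uIcc 0 x, f t = 0) :
    iterInt m f x = 0 :=
  (iterInt_congr m h).trans (iterInt_zero_fun m x)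

theorem iterInt_sub {f g : ℝ → ℝ} (hf : Continuous f) (hg : Continuous g) (m : ℕ) (x : ℝ) :
    iterInt m (fun y => f y - g y) x = iterInt m f x - iterInt m g x := by
  induction m generalizing x with
  | zero => rfl
  | succ m ih =>
    simp only [iterInt, ih]
    exact intervalIntegral.integral_sub ((continuous_iterInt hf m).intervalIntegrable _ _)
      ((continuous_iterInt hg m).intervalIntegrable _ _)

theorem iterInt_const_mul (c : ℝ) (f : ℝ → ℝ) (m : ℕ) (x : ℝ) :
    iterInt m (fun y => c * f y) x = c * iterInt m f x := by
  induction m generalizing x with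
  | zero => rfl
  | succ m ih => simp [iterInt, ih]

theorem iterInt_of_nonpos {f : ℝ → ℝ} (hf₀ : ∀ y ≤ 0, f y = 0) (m : ℕ) {x : ℝ} (hx : x ≤ 0) :
    iterInt m f x = 0 :=
  iterInt_eq_zero m fun t ht => hf₀ t (by rw [Set.uIcc_of_ge hx] at ht; exact ht.2)

theorem iterInt_comp_sub {f : ℝ → ℝ} (hf : Continuous f) (hf₀ : ∀ y ≤ 0, f y = 0) {a : ℝ}
    (ha : 0 ≤ a) (m : ℕ) (x : ℝ) :
    iterInt m (fun y => f (y - a)) x = iterInt m f (x - a) := by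
  induction m generalizing x with
  | zero => rfl
  | succ m ih =>
    have hi := fun u v => (continuous_iterInt hf m).intervalIntegrable (μ := volume) u v
    have h0 : ∫ t in (0 - a)..0, iterInt m f t = 0 := by
      rw [intervalIntegral.integral_congr (g := fun _ => (0 : ℝ)), intervalIntegral.integral_zero]
      intro t ht
      rw [Set.uIcc_of_le (by linarith)] at ht
      exact iterInt_of_nonpos hf₀ m ht.2
    simp only [iterInt, ih]
    rw [intervalIntegral.integral_comp_sub_right (iterInt m f),
      ← intervalIntegral.integral_add_adjacent_intervals (hi _ 0) (hi 0 _), h0, zero_add]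

/-! ### Iterated integrals of a row of triangles -/

theorem iterInt_triangleTrain_of_nonpos {w : ℝ} (hw : 0 < w) (q m : ℕ) {y : ℝ} (hy : y ≤ 0) :
    iterInt m (triangleTrain w q) y = 0 :=
  iterInt_of_nonpos (fun _ => triangleTrain_of_nonpos hw q) m hy

theorem iterInt_triangleTrain_succ {w : ℝ} (hw : 0 < w) (q m : ℕ) (y : ℝ) :
    iterInt m (triangleTrain w (q + 1)) y =
      iterInt m (triangleTrain w q) y - iterInt m (triangleTrain w q) (y - 2 ^ q * w) := by
  have hc := continuous_triangleTrain w q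
  rw [← iterInt_comp_sub hc (fun _ => triangleTrain_of_nonpos hw q) (by positivity)]
  exact iterInt_sub hc (hc.comp (continuous_id.sub continuous_const)) m y

theorem iterInt_one_triangleTrain_zero {w : ℝ} (hw : 0 < w) {y : ℝ} (hy : w ≤ y) :
    iterInt 1 (triangleTrain w 0) y = w / 2 := by
  have hi := fun u v => (continuous_triangleTrain w 0).intervalIntegrable (μ := volume) u v
  have h1 : ∫ t in (0 : ℝ)..(w / 2), triangleTrain w 0 t = w / 4 := by
    rw [intervalIntegral.integral_congr (g := fun t => 2 / w * t)]
    · rw [intervalIntegral.integral_const_mul, integral_id]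
      field_simp
      ring
    · intro t ht
      rw [Set.uIcc_of_le (by linarith)] at ht
      rw [triangleTrain_zero_of_le_half hw ht.1 ht.2]
  have h2 : ∫ t in (w / 2)..w, triangleTrain w 0 t = w / 4 := by
    rw [intervalIntegral.integral_congr (g := fun t => 2 - 2 / w * t)]
    · have hlin : Continuous fun t : ℝ => 2 / w * t := by fun_prop
      rw [intervalIntegral.integral_sub intervalIntegrable_const
        (hlin.intervalIntegrable _ _), intervalIntegral.integral_const_mul, integral_id]
      simp only [intervalIntegral.integral_const, smul_eq_mul]
      field_simp
      ring
    · intro t ht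
      rw [Set.uIcc_of_le (by linarith)] at ht
      rw [triangleTrain_zero_of_half_le hw ht.1 ht.2]
  have h3 : ∫ t in w..y, triangleTrain w 0 t = 0 := by
    rw [intervalIntegral.integral_congr (g := fun _ => (0 : ℝ)), intervalIntegral.integral_zero]
    intro t ht
    rw [Set.uIcc_of_le hy] at ht
    exact triangleTrain_of_ge hw 0 (by simpa using ht.1)
  change ∫ t in (0 : ℝ)..y, triangleTrain w 0 t = _
  rw [← intervalIntegral.integral_add_adjacent_intervals (hi 0 w) (hi w y),
    ← intervalIntegral.integral_add_adjacent_intervals (hi 0 (w / 2)) (hi _ w), h1, h2, h3]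
  ring

/-- The `q`-fold integral of a row of `2 ^ q` triangles is a nonnegative bump. The lower iterated
integrals vanish to the right of the row as well, and the area of the bump is explicit.

This is an induction on `q`: if `M` is the `q`-fold integral of one half of length `c`, the
`(q + 1)`-fold integral of the whole row is the moving integral `y ↦ ∫ t in (y - c)..y, M t`, so
that each step is a convolution with the indicator function of `[0, c]` and multiplies the area by
`c`. -/
theorem iterInt_triangleTrain_profile {w : ℝ} (hw : 0 < w) (q : ℕ) :
    (∀ y, 0 ≤ iterInt q (triangleTrain w q) y) ∧
    (∀ y, 2 ^ q * w ≤ y → ∀ m ≤ q, iterInt m (triangleTrain w q) y = 0) ∧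
    (∀ y, 2 ^ q * w ≤ y →
      iterInt (q + 1) (triangleTrain w q) y = w / 2 * ∏ i ∈ Finset.range q, (2 ^ i * w)) := by
  induction q with
  | zero =>
    refine ⟨fun y => le_max_left _ _, ?_, ?_⟩
    · intro y hy m hm
      obtain rfl : m = 0 := by omega
      exact triangleTrain_of_ge hw 0 hy
    · intro y hy
      rw [iterInt_one_triangleTrain_zero hw (by simpa using hy), Finset.prod_range_zero, mul_one]
  | succ q ih =>
    obtain ⟨ih1, ih2, ih3⟩ := ih
    have hL := continuous_triangleTrain w q
    set c : ℝ := 2 ^ q * w with hc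
    have hc0 : 0 < c := by positivity
    have hcc : (2 : ℝ) ^ (q + 1) * w = 2 * c := by rw [hc]; ring
    rw [hcc]
    have hi := fun u v => (continuous_iterInt hL q).intervalIntegrable (μ := volume) u v
    have hi' := fun u v => (continuous_iterInt hL (q + 1)).intervalIntegrable (μ := volume) u v
    have hvan : ∀ y, 2 * c ≤ y → ∀ m ≤ q + 1, iterInt m (triangleTrain w (q + 1)) y = 0 := by
      intro y hy m hm
      rw [iterInt_triangleTrain_succ hw]
      rcases Nat.lt_or_ge q m with h | h
      · obtain rfl : m = q + 1 := by omega
        rw [ih3 y (by linarith), ih3 (y - c) (by linarith), sub_self]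
      · rw [ih2 y (by linarith) m h, ih2 (y - c) (by linarith) m h, sub_self]
    refine ⟨fun y => ?_, hvan, fun y hy => ?_⟩
    · rw [iterInt_triangleTrain_succ hw]
      simp only [iterInt]
      rw [intervalIntegral.integral_interval_sub_left (hi _ _) (hi _ _)]
      exact intervalIntegral.integral_nonneg (by linarith) fun t _ => ih1 t
    · have hM := fun u v => (continuous_iterInt (continuous_triangleTrain w (q + 1))
        (q + 1)).intervalIntegrable (μ := volume) u v
      have h3 : ∫ t in (2 * c)..y, iterInt (q + 1) (triangleTrain w (q + 1)) t = 0 := by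
        rw [intervalIntegral.integral_congr (g := fun _ => (0 : ℝ)), intervalIntegral.integral_zero]
        intro t ht
        rw [Set.uIcc_of_le hy] at ht
        exact hvan t ht.1 _ le_rfl
      have h4 : ∫ t in (-c)..0, iterInt (q + 1) (triangleTrain w q) t = 0 := by
        rw [intervalIntegral.integral_congr (g := fun _ => (0 : ℝ)), intervalIntegral.integral_zero]
        intro t ht
        rw [Set.uIcc_of_le (by linarith)] at ht
        exact iterInt_triangleTrain_of_nonpos hw _ _ ht.2
      have h5 : ∫ t in c..(2 * c), iterInt (q + 1) (triangleTrain w q) t =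
          c * (w / 2 * ∏ i ∈ Finset.range q, (2 ^ i * w)) := by
        rw [intervalIntegral.integral_congr
          (g := fun _ => w / 2 * ∏ i ∈ Finset.range q, (2 ^ i * w)),
          intervalIntegral.integral_const, smul_eq_mul]
        · ring
        · intro t ht
          rw [Set.uIcc_of_le (by linarith)] at ht
          exact ih3 t ht.1
      change ∫ t in (0 : ℝ)..y, iterInt (q + 1) (triangleTrain w (q + 1)) t = _
      rw [← intervalIntegral.integral_add_adjacent_intervals (hM 0 (2 * c)) (hM _ y), h3, add_zero]
      simp only [iterInt_triangleTrain_succ hw q (q + 1)]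
      have hsh : Continuous fun t => iterInt (q + 1) (triangleTrain w q) (t - 2 ^ q * w) :=
        (continuous_iterInt hL (q + 1)).comp (continuous_id.sub continuous_const)
      rw [intervalIntegral.integral_sub (hi' _ _) (hsh.intervalIntegrable _ _),
        intervalIntegral.integral_comp_sub_right (iterInt (q + 1) (triangleTrain w q)),
        ← intervalIntegral.integral_add_adjacent_intervals (hi' 0 c) (hi' c _), h5]
      have e1 : 0 - c = -c := by ring
      have e2 : 2 * c - c = c := by ring
      rw [← hc, e1, e2, ← intervalIntegral.integral_add_adjacent_intervals (hi' (-c) 0) (hi' 0 c),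
        h4, Finset.prod_range_succ, ← hc]
      ring

/-! ### Heights -/

theorem rectHeight_pos {δ : ℝ} (hδ : 0 < δ) (q : ℕ) : 0 < rectHeight δ q := by
  induction q with
  | zero => exact one_div_pos.2 hδ
  | succ q ih => rw [rectHeight]; positivity

theorem rectHeight_eq_sqrt_two_pow {δ : ℝ} (hδ : 0 < δ) (q : ℕ) :
    rectHeight δ q = √2 ^ (q * (q + 1)) / δ ^ (q + 1) := by
  induction q with
  | zero => simp [rectHeight]
  | succ q ih =>
    have h : √2 ^ ((q + 1) * (q + 1 + 1)) = √2 ^ (q * (q + 1)) * (2 * 2 ^ q) := by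
      have h2 : (2 : ℝ) * 2 ^ q = √2 ^ (2 * (q + 1)) := by
        rw [pow_mul, Real.sq_sqrt (by norm_num), pow_succ]; ring
      rw [h2, ← pow_add]
      ring_nf
    rw [rectHeight, ih, h]
    field_simp
    ring

theorem two_mul_rectHeight_mul {δ : ℝ} (hδ : 0 < δ) (q : ℕ) :
    2 * rectHeight δ q * (2 / (2 * δ / 2 ^ q)) = rectHeight δ (q + 1) := by
  rw [rectHeight]
  field_simp

/-- The normalisation of the heights: the bump obtained from the triangles of level `q` has area
`2`, whatever `q` is. This is the area that cancels the mean of `1 / π` over a period. -/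
theorem rectHeight_mul_area {δ : ℝ} (hδ : 0 < δ) (q : ℕ) :
    2 * rectHeight δ q *
      (2 * δ / 2 ^ q / 2 * ∏ i ∈ Finset.range q, (2 ^ i * (2 * δ / 2 ^ q))) = 2 := by
  have h1 : ∀ n : ℕ, ∀ w : ℝ, rectHeight δ n * ∏ i ∈ Finset.range n, (2 ^ i * w) =
      2 ^ (n * n) * w ^ n / δ ^ (n + 1) := by
    intro n w
    induction n with
    | zero => simp [rectHeight]
    | succ n ih =>
      have : rectHeight δ (n + 1) * ∏ i ∈ Finset.range (n + 1), (2 ^ i * w) =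
          (rectHeight δ n * ∏ i ∈ Finset.range n, (2 ^ i * w)) *
            (2 / (δ / 2 ^ n) * (2 ^ n * w)) := by
        rw [rectHeight, Finset.prod_range_succ]; ring
      rw [this, ih]
      field_simp
      ring
  have h2 := h1 q (2 * δ / 2 ^ q)
  calc _ = 2 * (2 * δ / 2 ^ q / 2) *
        (rectHeight δ q * ∏ i ∈ Finset.range q, (2 ^ i * (2 * δ / 2 ^ q))) := by ring
    _ = 2 := by
      rw [h2, div_pow, mul_pow, ← pow_mul]
      field_simp
      ring

/-! ### The periodic triangles and their iterated integrals -/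

/-- `triangles` is the periodization of a row of triangles, scaled by the peak
`2 * rectHeight δ q` and with the opposite sign (the first triangle points downwards). -/
theorem triangles_eq {δ : ℝ} (hδ : 0 < δ) (q : ℕ) (x : ℝ) :
    triangles δ q x = -(2 * rectHeight δ q) *
      triangleTrain (2 * δ / 2 ^ q) q (toIcoMod Real.two_pi_pos 0 (x - (Real.pi - δ))) := by
  have hw : 0 < 2 * δ / 2 ^ q := by positivity
  have h0 := (toIcoMod_mem_Ico Real.two_pi_pos 0 (x - (Real.pi - δ))).1
  simp only [triangles]
  set y := toIcoMod Real.two_pi_pos 0 (x - (Real.pi - δ))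
  split_ifs with h
  · have hs : y / (2 * δ / 2 ^ q) < 2 ^ q := by
      rw [div_lt_iff₀ hw]; field_simp; exact h
    have := triangleTrain_mul_eq_pieceSign hw q (div_nonneg h0 hw.le) hs
    rw [div_mul_cancel₀ _ hw.ne'] at this
    rw [this]
    ring
  · rw [triangleTrain_of_ge hw q, mul_zero]
    field_simp
    exact not_lt.1 h

/-- A Lipschitz function that vanishes at both ends of a period has a Lipschitz periodization,
with the same constant. -/
theorem abs_comp_toIcoMod_sub_le {f : ℝ → ℝ} {K T : ℝ} (hT : 0 < T)
    (hf : ∀ x y, |f x - f y| ≤ K * |x - y|) (h0 : f 0 = 0) (h1 : f T = 0) (x y : ℝ) :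
    |f (toIcoMod hT 0 x) - f (toIcoMod hT 0 y)| ≤ K * |x - y| := by
  wlog hxy : x ≤ y generalizing x y
  · rw [abs_sub_comm, abs_sub_comm x]
    exact this y x (le_of_not_ge hxy)
  have hK : 0 ≤ K := by simpa using (abs_nonneg _).trans (hf 1 0)
  have hx := toIcoMod_mem_Ico hT 0 x
  have hy := toIcoMod_mem_Ico hT 0 y
  have ex := toIcoMod_add_toIcoDiv_zsmul hT 0 x
  have ey := toIcoMod_add_toIcoDiv_zsmul hT 0 y
  set a := toIcoMod hT 0 x
  set b := toIcoMod hT 0 y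
  rw [zero_add] at hx hy
  rw [zsmul_eq_mul] at ex ey
  have hle : toIcoDiv hT 0 x ≤ toIcoDiv hT 0 y := by
    by_contra! h
    have h2 : ((toIcoDiv hT 0 y : ℝ) + 1) * T ≤ toIcoDiv hT 0 x * T := by
      have : toIcoDiv hT 0 y + 1 ≤ toIcoDiv hT 0 x := h
      gcongr
      exact_mod_cast this
    linarith [hx.1, hy.2]
  rcases hle.eq_or_lt with h | h
  · rw [h] at ex
    have : x - y = a - b := by linarith
    rw [this]
    exact hf a b
  · -- `x` and `y` lie in different periods, so `y - x ≥ (T - a) + b`, and `f T = f 0 = 0`.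
    have h2 : ((toIcoDiv hT 0 x : ℝ) + 1) * T ≤ toIcoDiv hT 0 y * T := by
      have : toIcoDiv hT 0 x + 1 ≤ toIcoDiv hT 0 y := h
      gcongr
      exact_mod_cast this
    have h3 := hf a T
    have h4 := hf b 0
    rw [h1, sub_zero, abs_sub_comm a, abs_of_pos (by linarith [hx.2] : 0 < T - a)] at h3
    rw [h0, sub_zero, sub_zero, abs_of_nonneg hy.1] at h4
    have h5 := abs_sub (f a) (f b)
    rw [abs_sub_comm x, abs_of_nonneg (by linarith : 0 ≤ y - x)]
    calc |f a - f b| ≤ K * (T - a) + K * b := by linarith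
      _ = K * (T - a + b) := by ring
      _ ≤ K * (y - x) := by gcongr; linarith

variable {δ : ℝ}

theorem two_pow_mul_width (δ : ℝ) (q : ℕ) : 2 ^ q * (2 * δ / 2 ^ q) = 2 * δ := by
  field_simp

theorem abs_triangles_sub_le (hδ : 0 < δ) (hδπ : δ < Real.pi) (q : ℕ) (x y : ℝ) :
    |triangles δ q x - triangles δ q y| ≤ rectHeight δ (q + 1) * |x - y| := by
  have hw : 0 < 2 * δ / 2 ^ q := by positivity
  have hh := rectHeight_pos hδ q
  have := abs_comp_toIcoMod_sub_le Real.two_pi_pos (abs_triangleTrain_sub_le hw q)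
    (triangleTrain_of_nonpos hw q le_rfl)
    (triangleTrain_of_ge hw q (by rw [two_pow_mul_width]; linarith))
    (x - (Real.pi - δ)) (y - (Real.pi - δ))
  rw [triangles_eq hδ, triangles_eq hδ, ← mul_sub, abs_mul, abs_neg, abs_of_pos (by positivity),
    ← two_mul_rectHeight_mul hδ, mul_assoc _ (2 / _)]
  refine mul_le_mul_of_nonneg_left ?_ (by positivity)
  simpa using this

theorem continuous_triangles (hδ : 0 < δ) (hδπ : δ < Real.pi) (q : ℕ) :
    Continuous (triangles δ q) :=
  (LipschitzWith.of_dist_le_mul (K := (rectHeight δ (q + 1)).toNNReal) fun x y => by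
    rw [Real.coe_toNNReal _ (rectHeight_pos hδ _).le]
    exact abs_triangles_sub_le hδ hδπ q x y).continuous

theorem periodic_triangles (hδ : 0 < δ) (q : ℕ) :
    Function.Periodic (triangles δ q) (2 * Real.pi) := by
  intro x
  rw [triangles_eq hδ, triangles_eq hδ, add_sub_right_comm, toIcoMod_add_right]

theorem triangles_eq_zero (hδ : 0 < δ) (q : ℕ) {x : ℝ}
    (hx : x ∈ Set.Ioo (-Real.pi + δ) (Real.pi - δ)) : triangles δ q x = 0 := by
  have h : toIcoMod Real.two_pi_pos 0 (x - (Real.pi - δ)) = x - (Real.pi - δ) + 2 * Real.pi := by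
    rw [← toIcoMod_add_right, toIcoMod_eq_self]
    constructor <;> linarith [hx.1, hx.2]
  rw [triangles_eq hδ, h, triangleTrain_of_ge (by positivity), mul_zero]
  rw [two_pow_mul_width]
  linarith [hx.1]

theorem triangles_eq_of_mem_Icc (hδ : 0 < δ) (hδπ : δ < Real.pi) (q : ℕ) {x : ℝ}
    (hx : x ∈ Set.Icc 0 (2 * Real.pi)) :
    triangles δ q x =
      -(2 * rectHeight δ q) * triangleTrain (2 * δ / 2 ^ q) q (x - (Real.pi - δ)) := by
  have hw : 0 < 2 * δ / 2 ^ q := by positivity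
  rw [triangles_eq hδ]
  rcases le_or_gt (Real.pi - δ) x with h | h
  · rw [(toIcoMod_eq_self _).2 ⟨by linarith, by linarith [hx.2]⟩]
  · rw [← triangles_eq hδ, triangles_eq_zero hδ q ⟨by linarith [hx.1], h⟩,
      triangleTrain_of_nonpos hw q (by linarith), mul_zero]

theorem iterInt_triangles_eq (hδ : 0 < δ) (hδπ : δ < Real.pi) (q m : ℕ) {x : ℝ}
    (hx : x ∈ Set.Icc 0 (2 * Real.pi)) :
    iterInt m (triangles δ q) x = -(2 * rectHeight δ q) *
      iterInt m (triangleTrain (2 * δ / 2 ^ q) q) (x - (Real.pi - δ)) := by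
  have hw : 0 < 2 * δ / 2 ^ q := by positivity
  rw [← iterInt_comp_sub (continuous_triangleTrain _ q) (fun _ => triangleTrain_of_nonpos hw q)
    (by linarith), ← iterInt_const_mul]
  refine iterInt_congr m fun t ht => triangles_eq_of_mem_Icc hδ hδπ q ?_
  rw [Set.uIcc_of_le hx.1] at ht
  exact ⟨ht.1, ht.2.trans hx.2⟩

theorem periodic_integral_of_integral_eq_zero {f : ℝ → ℝ} (hf : Continuous f) {T : ℝ}
    (hT : Function.Periodic f T) (h : ∫ t in (0 : ℝ)..T, f t = 0) :
    Function.Periodic (fun x => ∫ t in (0 : ℝ)..x, f t) T := by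
  intro x
  have hi := fun u v => hf.intervalIntegrable (μ := volume) u v
  have := hT.intervalIntegral_add_eq x 0
  rw [zero_add, h] at this
  change ∫ t in (0 : ℝ)..(x + T), f t = ∫ t in (0 : ℝ)..x, f t
  rw [← intervalIntegral.integral_add_adjacent_intervals (hi 0 x) (hi x _), this, add_zero]

/-- Up to order `q` the iterated integrals remain periodic, since those of order `1, …, q` of the
row of triangles vanish to the right of the window. -/
theorem periodic_iterInt_triangles (hδ : 0 < δ) (hδπ : δ < Real.pi) {q m : ℕ} (hm : m ≤ q) :
    Function.Periodic (iterInt m (triangles δ q)) (2 * Real.pi) := by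
  induction m with
  | zero => exact periodic_triangles hδ q
  | succ m ih =>
    have hw : 0 < 2 * δ / 2 ^ q := by positivity
    refine periodic_integral_of_integral_eq_zero
      (continuous_iterInt (continuous_triangles hδ hδπ q) m) (ih (by omega)) ?_
    change iterInt (m + 1) (triangles δ q) (2 * Real.pi) = 0
    rw [iterInt_triangles_eq hδ hδπ q _ ⟨Real.two_pi_pos.le, le_rfl⟩,
      (iterInt_triangleTrain_profile hw q).2.1 _ _ _ hm, mul_zero]
    rw [two_pow_mul_width]
    linarith

theorem iterInt_succ_triangles_two_pi (hδ : 0 < δ) (hδπ : δ < Real.pi) (q : ℕ) :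
    iterInt (q + 1) (triangles δ q) (2 * Real.pi) = -2 := by
  have hw : 0 < 2 * δ / 2 ^ q := by positivity
  rw [iterInt_triangles_eq hδ hδπ q _ ⟨Real.two_pi_pos.le, le_rfl⟩,
    (iterInt_triangleTrain_profile hw q).2.2 _ (by rw [two_pow_mul_width]; linarith), neg_mul,
    rectHeight_mul_area hδ]

/-! ### Periodicity, bound and smoothness of the phase function -/

theorem phaseFun_succ_eq (hδ : 0 < δ) (hδπ : δ < Real.pi) (q : ℕ) (x : ℝ) :
    phaseFun δ (q + 1) x = x / Real.pi + iterInt (q + 1) (triangles δ q) x := by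
  simp only [phaseFun, Nat.add_sub_cancel]
  rw [intervalIntegral.integral_add intervalIntegrable_const
    ((continuous_iterInt (continuous_triangles hδ hδπ q) q).intervalIntegrable _ _),
    intervalIntegral.integral_const, sub_zero, smul_eq_mul, mul_one_div]
  rfl

theorem periodic_phaseFun (hδ : 0 < δ) (hδπ : δ < Real.pi) (q : ℕ) :
    Function.Periodic (phaseFun δ (q + 1)) (2 * Real.pi) := by
  refine periodic_integral_of_integral_eq_zero
    (continuous_const.add (continuous_iterInt (continuous_triangles hδ hδπ q) q)) ?_ ?_
  · intro x
    change 1 / Real.pi + iterInt q (triangles δ q) (x + 2 * Real.pi) =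
      1 / Real.pi + iterInt q (triangles δ q) x
    rw [periodic_iterInt_triangles hδ hδπ le_rfl x]
  · change phaseFun δ (q + 1) (2 * Real.pi) = 0
    rw [phaseFun_succ_eq hδ hδπ, iterInt_succ_triangles_two_pi hδ hδπ,
      mul_div_cancel_right₀ _ Real.pi_ne_zero]
    norm_num

theorem phaseFun_eq_div_pi (hδ : 0 < δ) (hδπ : δ < Real.pi) (q : ℕ) {x : ℝ}
    (hx : x ∈ Set.Ioo (-Real.pi + δ) (Real.pi - δ)) :
    phaseFun δ (q + 1) x = x / Real.pi := by
  rw [phaseFun_succ_eq hδ hδπ, iterInt_eq_zero, add_zero]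
  intro t ht
  refine triangles_eq_zero hδ q ?_
  exact Set.OrdConnected.uIcc_subset Set.ordConnected_Ioo ⟨by linarith, by linarith⟩ hx ht

/-- On a period the function is `x / π`, which lies in `[0, 2]`, minus the increasing integral of
a nonnegative bump of area `2`. -/
theorem abs_phaseFun_le_two (hδ : 0 < δ) (hδπ : δ < Real.pi) (q : ℕ) (x : ℝ) :
    |phaseFun δ (q + 1) x| ≤ 2 := by
  obtain ⟨y, hy, hxy⟩ := (periodic_phaseFun hδ hδπ q).exists_mem_Ico₀ Real.two_pi_pos x
  have hw : 0 < 2 * δ / 2 ^ q := by positivity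
  obtain ⟨h1, -, h3⟩ := iterInt_triangleTrain_profile hw q
  have hmono : Monotone (iterInt (q + 1) (triangleTrain (2 * δ / 2 ^ q) q)) := by
    have hd := hasDerivAt_iterInt_succ (continuous_triangleTrain (2 * δ / 2 ^ q) q) q
    refine monotone_of_deriv_nonneg (fun t => (hd t).differentiableAt) fun t => ?_
    rw [(hd t).deriv]
    exact h1 t
  set N := iterInt (q + 1) (triangleTrain (2 * δ / 2 ^ q) q)
  have hlow : 0 ≤ N (y - (Real.pi - δ)) := by
    rw [← iterInt_triangleTrain_of_nonpos hw q (q + 1) (min_le_right (y - (Real.pi - δ)) 0)]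
    exact hmono (min_le_left _ _)
  have hup : 2 * rectHeight δ q * N (y - (Real.pi - δ)) ≤ 2 := by
    have hh := rectHeight_pos hδ q
    calc _ ≤ 2 * rectHeight δ q * N (max (y - (Real.pi - δ)) (2 ^ q * (2 * δ / 2 ^ q))) := by
          gcongr
          exact hmono (le_max_left _ _)
      _ = 2 := by rw [h3 _ (le_max_right _ _), rectHeight_mul_area hδ q]
  have hh : 0 ≤ 2 * rectHeight δ q * N (y - (Real.pi - δ)) :=
    mul_nonneg (by linarith [rectHeight_pos hδ q]) hlow
  have h4 : 0 ≤ y / Real.pi := div_nonneg hy.1 Real.pi_pos.le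
  have h5 : y / Real.pi ≤ 2 := by rw [div_le_iff₀ Real.pi_pos]; exact hy.2.le
  rw [hxy, phaseFun_succ_eq hδ hδπ, iterInt_triangles_eq hδ hδπ q _ ⟨hy.1, hy.2.le⟩, abs_le]
  constructor <;> linarith

theorem contDiff_const_add_iterInt {f : ℝ → ℝ} (hf : Continuous f) (c : ℝ) (m : ℕ) :
    ContDiff ℝ m (fun x => c + iterInt m f x) := by
  induction m generalizing c with
  | zero => exact contDiff_zero.2 (continuous_const.add hf)
  | succ m ih =>
    have hd := fun x => (hasDerivAt_iterInt_succ hf m x).const_add c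
    have hderiv : deriv (fun x => c + iterInt (m + 1) f x) = fun x => 0 + iterInt m f x :=
      funext fun x => by rw [(hd x).deriv, zero_add]
    push_cast
    refine contDiff_succ_iff_deriv.2 ⟨fun x => (hd x).differentiableAt, by simp, ?_⟩
    rw [hderiv]
    exact ih 0

theorem iteratedDeriv_const_add_iterInt {f : ℝ → ℝ} (hf : Continuous f) (c : ℝ) (m : ℕ) :
    ∃ c' : ℝ, iteratedDeriv m (fun x => c + iterInt m f x) = fun x => c' + f x := by
  induction m generalizing c with
  | zero => exact ⟨c, rfl⟩
  | succ m ih =>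
    have hderiv : deriv (fun x => c + iterInt (m + 1) f x) = fun x => 0 + iterInt m f x :=
      funext fun x => by rw [((hasDerivAt_iterInt_succ hf m x).const_add c).deriv, zero_add]
    rw [iteratedDeriv_succ', hderiv]
    exact ih 0

theorem hasDerivAt_phaseFun (hδ : 0 < δ) (hδπ : δ < Real.pi) (q : ℕ) (x : ℝ) :
    HasDerivAt (phaseFun δ (q + 1)) (1 / Real.pi + iterInt q (triangles δ q) x) x :=
  ((continuous_const.add (continuous_iterInt (continuous_triangles hδ hδπ q)
    q)).integral_hasStrictDerivAt 0 x).hasDerivAt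

theorem deriv_phaseFun (hδ : 0 < δ) (hδπ : δ < Real.pi) (q : ℕ) :
    deriv (phaseFun δ (q + 1)) = fun x => 1 / Real.pi + iterInt q (triangles δ q) x :=
  funext fun x => (hasDerivAt_phaseFun hδ hδπ q x).deriv

theorem contDiff_phaseFun (hδ : 0 < δ) (hδπ : δ < Real.pi) (q : ℕ) :
    ContDiff ℝ ((q + 1 : ℕ) : WithTop ℕ∞) (phaseFun δ (q + 1)) := by
  push_cast
  refine contDiff_succ_iff_deriv.2
    ⟨fun x => (hasDerivAt_phaseFun hδ hδπ q x).differentiableAt, by simp, ?_⟩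
  rw [deriv_phaseFun hδ hδπ]
  exact contDiff_const_add_iterInt (continuous_triangles hδ hδπ q) _ q

theorem abs_iteratedDeriv_phaseFun_sub_le (hδ : 0 < δ) (hδπ : δ < Real.pi) (q : ℕ) (x y : ℝ) :
    |iteratedDeriv (q + 1) (phaseFun δ (q + 1)) x - iteratedDeriv (q + 1) (phaseFun δ (q + 1)) y| ≤
      rectHeight δ (q + 1) * |x - y| := by
  obtain ⟨c, hc⟩ := iteratedDeriv_const_add_iterInt (continuous_triangles hδ hδπ q) (1 / Real.pi) q
  rw [iteratedDeriv_succ', deriv_phaseFun hδ hδπ, hc, add_sub_add_left_eq_sub]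
  exact abs_triangles_sub_le hδ hδπ q x y

theorem circleFun_exp (hδ : 0 < δ) (hδπ : δ < Real.pi) (q : ℕ) (x : ℝ) :
    circleFun δ (q + 1) (Circle.exp x) = phaseFun δ (q + 1) x := by
  rw [circleFun, Circle.coe_exp, Complex.arg_exp_mul_I, toIocMod,
    (periodic_phaseFun hδ hδπ q).sub_zsmul_eq]

/-! ### Fourier transform of a row of triangles -/

/-- The formula comes from the antiderivative `-((α + β t) / c + β / c ^ 2) * exp (-c t)`. -/
theorem integral_affine_mul_exp {c : ℂ} (hc : c ≠ 0) (α β : ℂ) (a b : ℝ) :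
    ∫ t in a..b, (α + β * t) * Complex.exp (-(c * t)) =
      ((α + β * a) / c + β / c ^ 2) * Complex.exp (-(c * a)) -
        ((α + β * b) / c + β / c ^ 2) * Complex.exp (-(c * b)) := by
  have hd : ∀ t : ℝ, HasDerivAt
      (fun t : ℝ => -(((α + β * t) / c + β / c ^ 2) * Complex.exp (-(c * t))))
      ((α + β * t) * Complex.exp (-(c * t))) t := by
    intro t
    have h1 : HasDerivAt (fun t : ℝ => (t : ℂ)) 1 t := (hasDerivAt_id t).ofReal_comp
    have h2 := ((((h1.const_mul β).const_add α).div_const c).add_const (β / c ^ 2)).mul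
      (h1.const_mul c).neg.cexp
    convert! h2.neg using 1
    simp only [Pi.neg_apply]
    field_simp
    ring
  rw [intervalIntegral.integral_eq_sub_of_hasDerivAt (fun t _ => hd t)]
  · ring
  · exact Continuous.intervalIntegrable (by fun_prop) _ _

theorem hasCompactSupport_triangleTrain {w : ℝ} (hw : 0 < w) (q : ℕ) :
    HasCompactSupport (triangleTrain w q) := by
  refine HasCompactSupport.of_support_subset_isCompact (isCompact_Icc (a := 0) (b := 2 ^ q * w)) ?_
  intro y hy
  by_contra h
  rw [Set.mem_Icc, not_and_or, not_le, not_le] at h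
  rcases h with h | h
  · exact hy (triangleTrain_of_nonpos hw q h.le)
  · exact hy (triangleTrain_of_ge hw q h.le)

theorem integrable_triangleTrain_mul_exp {w : ℝ} (hw : 0 < w) (q : ℕ) (c : ℂ) :
    Integrable fun s : ℝ => (triangleTrain w q s : ℂ) * Complex.exp (-(c * s)) := by
  have hL := continuous_triangleTrain w q
  refine Continuous.integrable_of_hasCompactSupport (by fun_prop) ?_
  exact ((hasCompactSupport_triangleTrain hw q).comp_left Complex.ofReal_zero).mul_right

theorem integral_comp_sub_mul_exp (f : ℝ → ℝ) (a : ℝ) (c : ℂ) :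
    ∫ s : ℝ, (f (s - a) : ℂ) * Complex.exp (-(c * s)) =
      Complex.exp (-(c * a)) * ∫ s : ℝ, (f s : ℂ) * Complex.exp (-(c * s)) := by
  rw [← integral_const_mul,
    ← integral_sub_right_eq_self (fun s : ℝ => _ * ((f s : ℂ) * Complex.exp (-(c * s)))) a]
  congr 1
  ext s
  rw [mul_left_comm, ← Complex.exp_add]
  congr 2
  push_cast
  ring

theorem norm_exp_neg_I_mul (ξ s : ℝ) : ‖Complex.exp (-(Complex.I * ξ * s))‖ = 1 := by
  have : -(Complex.I * ξ * s) = ((-(ξ * s) : ℝ) : ℂ) * Complex.I := by push_cast; ring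
  rw [this, Complex.norm_exp_ofReal_mul_I]

/-- A single triangle has Fourier transform of size at most `8 / (w ξ ^ 2)`, being a second
difference of an exponential times `2 / (w ξ ^ 2)`; doubling the row at most doubles the bound. -/
theorem norm_integral_triangleTrain_mul_exp_le {w : ℝ} (hw : 0 < w) (q : ℕ) {ξ : ℝ} (hξ : ξ ≠ 0) :
    ‖∫ s : ℝ, (triangleTrain w q s : ℂ) * Complex.exp (-(Complex.I * ξ * s))‖ ≤
      2 ^ q * (8 / (w * ξ ^ 2)) := by
  induction q with
  | zero =>
    have hc : Complex.I * ξ ≠ 0 := mul_ne_zero Complex.I_ne_zero (Complex.ofReal_ne_zero.2 hξ)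
    have hwc : (w : ℂ) ≠ 0 := Complex.ofReal_ne_zero.2 hw.ne'
    have hi := fun u v => (integrable_triangleTrain_mul_exp hw 0
      (Complex.I * ξ)).intervalIntegrable (a := u) (b := v)
    have h0 : ∫ s : ℝ, (triangleTrain w 0 s : ℂ) * Complex.exp (-(Complex.I * ξ * s)) =
        ∫ s in (0 : ℝ)..w, (triangleTrain w 0 s : ℂ) * Complex.exp (-(Complex.I * ξ * s)) := by
      refine (intervalIntegral.integral_eq_integral_of_support_subset ?_).symm
      intro s hs
      by_contra h
      rw [Set.mem_Ioc, not_and_or, not_lt, not_le] at h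
      refine hs ?_
      rcases h with h | h
      · simp [triangleTrain_of_nonpos hw 0 h]
      · simp [triangleTrain_of_ge hw 0 (y := s) (by simpa using h.le)]
    have h1 : ∫ s in (0 : ℝ)..(w / 2),
        (triangleTrain w 0 s : ℂ) * Complex.exp (-(Complex.I * ξ * s)) =
        ∫ s in (0 : ℝ)..(w / 2), (0 + (2 / w : ℂ) * s) * Complex.exp (-(Complex.I * ξ * s)) := by
      refine intervalIntegral.integral_congr fun t ht => ?_
      rw [Set.uIcc_of_le (by linarith)] at ht
      simp only [triangleTrain_zero_of_le_half hw ht.1 ht.2]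
      push_cast
      ring
    have h2 : ∫ s in (w / 2)..w,
        (triangleTrain w 0 s : ℂ) * Complex.exp (-(Complex.I * ξ * s)) =
        ∫ s in (w / 2)..w, (2 + (-(2 / w) : ℂ) * s) * Complex.exp (-(Complex.I * ξ * s)) := by
      refine intervalIntegral.integral_congr fun t ht => ?_
      rw [Set.uIcc_of_le (by linarith)] at ht
      simp only [triangleTrain_zero_of_half_le hw ht.1 ht.2]
      push_cast
      ring
    have key : ∫ s : ℝ, (triangleTrain w 0 s : ℂ) * Complex.exp (-(Complex.I * ξ * s)) =
        2 / w / (Complex.I * ξ) ^ 2 * (1 - Complex.exp (-(Complex.I * ξ * (w / 2 : ℝ))) -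
          Complex.exp (-(Complex.I * ξ * (w / 2 : ℝ))) + Complex.exp (-(Complex.I * ξ * w))) := by
      rw [h0, ← intervalIntegral.integral_add_adjacent_intervals (hi 0 (w / 2)) (hi _ w), h1, h2,
        integral_affine_mul_exp hc, integral_affine_mul_exp hc]
      push_cast
      rw [mul_zero, mul_zero, neg_zero, Complex.exp_zero]
      field_simp
      ring
    have hn : ‖(1 : ℂ) - Complex.exp (-(Complex.I * ξ * (w / 2 : ℝ))) -
          Complex.exp (-(Complex.I * ξ * (w / 2 : ℝ))) + Complex.exp (-(Complex.I * ξ * w))‖ ≤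
        4 := by
      refine (norm_add_le _ _).trans ?_
      have a1 := norm_sub_le ((1 : ℂ) - Complex.exp (-(Complex.I * ξ * (w / 2 : ℝ))))
        (Complex.exp (-(Complex.I * ξ * (w / 2 : ℝ))))
      have a2 := norm_sub_le (1 : ℂ) (Complex.exp (-(Complex.I * ξ * (w / 2 : ℝ))))
      rw [norm_exp_neg_I_mul] at a1 a2 ⊢
      rw [norm_one] at a2
      linarith
    rw [key, norm_mul, norm_div, norm_div, norm_pow, norm_mul, Complex.norm_I, one_mul,
      Complex.norm_real, Complex.norm_real, Real.norm_of_nonneg hw.le, Real.norm_eq_abs, sq_abs,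
      Complex.norm_ofNat]
    calc _ ≤ 2 / w / ξ ^ 2 * 4 := by gcongr
      _ = _ := by field_simp; norm_num
  | succ q ih =>
    have hi := integrable_triangleTrain_mul_exp hw q (Complex.I * ξ)
    have hi' : Integrable fun s : ℝ =>
        (triangleTrain w q (s - 2 ^ q * w) : ℂ) * Complex.exp (-(Complex.I * ξ * s)) := by
      refine Integrable.congr
        ((hi.comp_sub_right (2 ^ q * w)).const_mul
          (Complex.exp (-(Complex.I * ξ * (2 ^ q * w : ℝ)))))
        (Filter.Eventually.of_forall fun s => ?_)
      simp only
      rw [mul_left_comm, ← Complex.exp_add]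
      congr 2
      push_cast
      ring
    have hsplit : ∀ s : ℝ, (triangleTrain w (q + 1) s : ℂ) * Complex.exp (-(Complex.I * ξ * s)) =
        (triangleTrain w q s : ℂ) * Complex.exp (-(Complex.I * ξ * s)) -
        (triangleTrain w q (s - 2 ^ q * w) : ℂ) * Complex.exp (-(Complex.I * ξ * s)) := by
      intro s
      simp only [triangleTrain]
      push_cast
      ring
    simp only [hsplit]
    rw [integral_sub hi hi', integral_comp_sub_mul_exp]
    refine (norm_sub_le _ _).trans ?_
    rw [norm_mul, norm_exp_neg_I_mul, one_mul, pow_succ]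
    linarith

/-! ### Fourier coefficients of the phase function -/

theorem integral_exp_neg_I_int_mul {n : ℤ} (hn : n ≠ 0) :
    ∫ t in (-Real.pi)..Real.pi, Complex.exp (-(Complex.I * n * t)) = 0 := by
  have hc : -(Complex.I * n) ≠ 0 :=
    neg_ne_zero.2 (mul_ne_zero Complex.I_ne_zero (Int.cast_ne_zero.2 hn))
  have h := integral_exp_mul_complex (a := -Real.pi) (b := Real.pi) hc
  simp only [neg_mul] at h
  rw [h, div_eq_zero_iff]
  left
  rw [sub_eq_zero, Complex.exp_eq_exp_iff_exists_int]
  exact ⟨-n, by push_cast; ring⟩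

theorem exp_neg_I_int_mul_add_two_pi (n : ℤ) (t : ℝ) :
    Complex.exp (-(Complex.I * n * (t + 2 * Real.pi : ℝ))) = Complex.exp (-(Complex.I * n * t)) :=
  Complex.exp_eq_exp_iff_exists_int.2 ⟨-n, by push_cast; ring⟩

theorem fourierCoefficient_const_add {f : ℝ → ℝ} (hf : Continuous f) (c : ℝ) {n : ℤ} (hn : n ≠ 0) :
    fourierCoefficient (fun x => c + f x) n = fourierCoefficient f n := by
  have h : ∀ t : ℝ, ((c + f t : ℝ) : ℂ) * Complex.exp (-(Complex.I * n * t)) =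
      c * Complex.exp (-(Complex.I * n * t)) + f t * Complex.exp (-(Complex.I * n * t)) := by
    intro t; push_cast; ring
  simp only [fourierCoefficient, h]
  rw [intervalIntegral.integral_add (Continuous.intervalIntegrable (by fun_prop) _ _)
    (Continuous.intervalIntegrable (by fun_prop) _ _), intervalIntegral.integral_const_mul,
    integral_exp_neg_I_int_mul hn, mul_zero, zero_add]

theorem fourierCoefficient_deriv {f f' : ℝ → ℝ} (hper : Function.Periodic f (2 * Real.pi))
    (hf : ∀ x, HasDerivAt f (f' x) x) (hf' : Continuous f') (n : ℤ) :
    fourierCoefficient f' n = Complex.I * n * fourierCoefficient f n := by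
  have hfc : Continuous f := continuous_iff_continuousAt.2 fun x => (hf x).continuousAt
  have hv : ∀ t : ℝ, HasDerivAt (fun t : ℝ => Complex.exp (-(Complex.I * n * t)))
      (Complex.exp (-(Complex.I * n * t)) * -(Complex.I * n)) t := by
    intro t
    have h1 : HasDerivAt (fun t : ℝ => (t : ℂ)) 1 t := (hasDerivAt_id t).ofReal_comp
    simpa using (h1.const_mul (Complex.I * n)).neg.cexp
  have hb : (f Real.pi : ℂ) * Complex.exp (-(Complex.I * n * Real.pi)) =
      f (-Real.pi) * Complex.exp (-(Complex.I * n * (-Real.pi : ℝ))) := by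
    have e : -Real.pi + 2 * Real.pi = Real.pi := by ring
    rw [← exp_neg_I_int_mul_add_two_pi n (-Real.pi), ← hper (-Real.pi), e]
  have key := intervalIntegral.integral_mul_deriv_eq_deriv_mul
    (a := -Real.pi) (b := Real.pi) (fun t _ => (hf t).ofReal_comp) (fun t _ => hv t)
    (Continuous.intervalIntegrable (by fun_prop) _ _)
    (Continuous.intervalIntegrable (by fun_prop) _ _)
  have h2 : ∫ t in (-Real.pi)..Real.pi,
      (f t : ℂ) * (Complex.exp (-(Complex.I * n * t)) * -(Complex.I * n)) =
      -(Complex.I * n) *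
        ∫ t in (-Real.pi)..Real.pi, (f t : ℂ) * Complex.exp (-(Complex.I * n * t)) := by
    rw [← intervalIntegral.integral_const_mul]
    congr 1
    ext t
    ring
  rw [h2, hb, sub_self, zero_sub, neg_mul, neg_inj] at key
  simp only [fourierCoefficient]
  rw [← key]
  ring

theorem norm_fourierCoefficient_triangles_le (hδ : 0 < δ) (hδπ : δ < Real.pi) (q : ℕ) {n : ℤ}
    (hn : n ≠ 0) :
    ‖fourierCoefficient (triangles δ q) n‖ ≤
      2 ^ (q + 2) * rectHeight δ (q + 1) / (2 * Real.pi) / |(n : ℝ)| ^ 2 := by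
  have hw : 0 < 2 * δ / 2 ^ q := by positivity
  have hh := rectHeight_pos hδ q
  have hn' : (n : ℝ) ≠ 0 := Int.cast_ne_zero.2 hn
  have hper : Function.Periodic
      (fun t : ℝ => (triangles δ q t : ℂ) * Complex.exp (-(Complex.I * n * t))) (2 * Real.pi) := by
    intro t
    simp only [periodic_triangles hδ q t, exp_neg_I_int_mul_add_two_pi]
  have h1 := hper.intervalIntegral_add_eq (-Real.pi) 0
  have e : -Real.pi + 2 * Real.pi = Real.pi := by ring
  rw [e, zero_add] at h1
  have h2 : ∫ t in (0 : ℝ)..(2 * Real.pi),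
      (triangles δ q t : ℂ) * Complex.exp (-(Complex.I * n * t)) =
      -(2 * rectHeight δ q) * ∫ t in (0 : ℝ)..(2 * Real.pi),
        (triangleTrain (2 * δ / 2 ^ q) q (t - (Real.pi - δ)) : ℂ) *
          Complex.exp (-(Complex.I * n * t)) := by
    rw [← intervalIntegral.integral_const_mul]
    refine intervalIntegral.integral_congr fun t ht => ?_
    rw [Set.uIcc_of_le Real.two_pi_pos.le] at ht
    simp only [triangles_eq_of_mem_Icc hδ hδπ q ht]
    push_cast
    ring
  have h3 : ∫ t in (0 : ℝ)..(2 * Real.pi),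
        (triangleTrain (2 * δ / 2 ^ q) q (t - (Real.pi - δ)) : ℂ) *
          Complex.exp (-(Complex.I * n * t)) =
      ∫ t : ℝ, (triangleTrain (2 * δ / 2 ^ q) q (t - (Real.pi - δ)) : ℂ) *
          Complex.exp (-(Complex.I * n * t)) := by
    refine intervalIntegral.integral_eq_integral_of_support_subset ?_
    intro s hs
    by_contra h
    rw [Set.mem_Ioc, not_and_or, not_lt, not_le] at h
    refine hs ?_
    rcases h with h | h
    · simp [triangleTrain_of_nonpos hw q (y := s - (Real.pi - δ)) (by linarith)]
    · simp [triangleTrain_of_ge hw q (y := s - (Real.pi - δ))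
        (by rw [two_pow_mul_width]; linarith)]
  have h4 := norm_integral_triangleTrain_mul_exp_le hw q hn'
  rw [Complex.ofReal_intCast] at h4
  have h5 := norm_exp_neg_I_mul n (Real.pi - δ)
  rw [Complex.ofReal_intCast] at h5
  have h6 : ‖(1 / (2 * Real.pi) : ℂ)‖ = 1 / (2 * Real.pi) := by
    rw [norm_div, norm_one, norm_mul, Complex.norm_real, Real.norm_of_nonneg Real.pi_pos.le,
      Complex.norm_ofNat]
  have h7 : ‖(-(2 * rectHeight δ q) : ℂ)‖ = 2 * rectHeight δ q := by
    rw [norm_neg, norm_mul, Complex.norm_real, Real.norm_of_nonneg hh.le, Complex.norm_ofNat]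
  rw [fourierCoefficient, h1, h2, h3, integral_comp_sub_mul_exp, norm_mul, norm_mul, norm_mul, h5,
    h6, h7, one_mul, ← two_mul_rectHeight_mul hδ, sq_abs]
  calc _ ≤ 1 / (2 * Real.pi) *
        (2 * rectHeight δ q * (2 ^ q * (8 / (2 * δ / 2 ^ q * (n : ℝ) ^ 2)))) := by gcongr
    _ = _ := by
      field_simp
      ring

theorem norm_fourierCoefficient_iterInt_triangles (hδ : 0 < δ) (hδπ : δ < Real.pi) {q m : ℕ}
    (hm : m ≤ q) (c : ℝ) {n : ℤ} (hn : n ≠ 0) :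
    ‖fourierCoefficient (fun x => c + iterInt m (triangles δ q) x) n‖ =
      ‖fourierCoefficient (triangles δ q) n‖ / |(n : ℝ)| ^ m := by
  have hτ := continuous_triangles hδ hδπ q
  have hn' : (n : ℝ) ≠ 0 := Int.cast_ne_zero.2 hn
  induction m generalizing c with
  | zero =>
    change ‖fourierCoefficient (fun x => c + triangles δ q x) n‖ = _
    rw [fourierCoefficient_const_add hτ c hn, pow_zero, div_one]
  | succ m ih =>
    have h := fourierCoefficient_deriv (f := iterInt (m + 1) (triangles δ q))
      (periodic_iterInt_triangles hδ hδπ hm) (hasDerivAt_iterInt_succ hτ m)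
      (continuous_iterInt hτ m) n
    have h2 := ih (by omega) 0
    simp only [zero_add] at h2
    rw [h, norm_mul, norm_mul, Complex.norm_I, Complex.norm_intCast, one_mul] at h2
    rw [fourierCoefficient_const_add (continuous_iterInt hτ _) c hn, pow_succ, ← div_div, ← h2]
    field_simp

/-- With `p = q + 1`, the bound decays like `|n| ^ (-(p + 2))`, one power better than the
Lipschitz property of the `p`-th derivative alone gives. The price is the number `2 ^ p` of pieces
on which the next derivative is constant, which only costs a bounded factor in the degree after
taking a `(p + 1)`-th root. -/
theorem norm_fourierCoefficient_phaseFun_le (hδ : 0 < δ) (hδπ : δ < Real.pi) (q : ℕ) {n : ℤ}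
    (hn : n ≠ 0) :
    ‖fourierCoefficient (phaseFun δ (q + 1)) n‖ ≤
      2 ^ (q + 2) * rectHeight δ (q + 1) / (2 * Real.pi) / |(n : ℝ)| ^ (q + 3) := by
  have hn' : (n : ℝ) ≠ 0 := Int.cast_ne_zero.2 hn
  have h := fourierCoefficient_deriv (periodic_phaseFun hδ hδπ q) (hasDerivAt_phaseFun hδ hδπ q)
    (continuous_const.add (continuous_iterInt (continuous_triangles hδ hδπ q) q)) n
  have h2 := norm_fourierCoefficient_iterInt_triangles hδ hδπ (le_refl q) (1 / Real.pi) hn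
  rw [h, norm_mul, norm_mul, Complex.norm_I, Complex.norm_intCast, one_mul] at h2
  have h3 := norm_fourierCoefficient_triangles_le hδ hδπ q hn
  have h4 : ‖fourierCoefficient (phaseFun δ (q + 1)) n‖ =
      ‖fourierCoefficient (triangles δ q) n‖ / |(n : ℝ)| ^ q / |(n : ℝ)| := by
    rw [← h2]; field_simp
  rw [h4]
  calc _ ≤ 2 ^ (q + 2) * rectHeight δ (q + 1) / (2 * Real.pi) / |(n : ℝ)| ^ 2 /
        |(n : ℝ)| ^ q / |(n : ℝ)| := by gcongr
    _ = _ := by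
      field_simp
      ring

/-! ### Fourier sums of functions with rapidly decreasing coefficients -/

theorem hasSum_fourierCoefficient {f : ℝ → ℝ} (hf : Continuous f)
    (hper : Function.Periodic f (2 * Real.pi)) (hs : Summable (fourierCoefficient f)) (x : ℝ) :
    HasSum (fun n : ℤ => fourierCoefficient f n * Complex.exp (Complex.I * n * x)) (f x : ℂ) := by
  have : Fact (0 < 2 * Real.pi) := ⟨Real.two_pi_pos⟩
  have hper' : Function.Periodic (fun t : ℝ => (f t : ℂ)) (2 * Real.pi) := fun t => by
    simp only [hper t]
  let F : C(AddCircle (2 * Real.pi), ℂ) :=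
    ⟨hper'.lift, continuous_coinduced_dom.2 (Complex.continuous_ofReal.comp hf)⟩
  have hexp : ∀ (n : ℤ) (t : ℝ), fourier n (t : AddCircle (2 * Real.pi)) =
      Complex.exp (Complex.I * n * t) := by
    intro n t
    rw [fourier_coe_apply]
    congr 1
    have : (Real.pi : ℂ) ≠ 0 := Complex.ofReal_ne_zero.2 Real.pi_ne_zero
    push_cast
    field_simp
  have hcoeff : fourierCoeff F = fourierCoefficient f := by
    ext n
    have e : -Real.pi + 2 * Real.pi = Real.pi := by ring
    rw [fourierCoeff_eq_intervalIntegral _ n (-Real.pi), e, fourierCoefficient, Complex.real_smul]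
    push_cast
    congr 1
    refine intervalIntegral.integral_congr fun t _ => ?_
    simp only [hexp, smul_eq_mul]
    rw [mul_comm]
    congr 2
    push_cast
    ring
  have := has_pointwise_sum_fourier_series_of_summable (f := F) (hcoeff ▸ hs) (x : AddCircle _)
  simp only [hcoeff, hexp, smul_eq_mul] at this
  exact this

/-- Coefficients of size `B / |n| ^ (r + 2)` give an error of order `B / d ^ (r + 1)`, uniformly
in `r`, for the Fourier sum of degree `d`, by a telescoping bound on the tail. -/
theorem norm_fourierSum_sub_le {f : ℝ → ℝ} (hf : Continuous f)
    (hper : Function.Periodic f (2 * Real.pi)) {B : ℝ} (r : ℕ)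
    (hB : ∀ n : ℤ, n ≠ 0 → ‖fourierCoefficient f n‖ ≤ B / |(n : ℝ)| ^ (r + 2)) (d : ℕ) (x : ℝ) :
    ‖fourierSum f d x - f x‖ ≤ 4 * B / ((d : ℝ) + 1) ^ (r + 1) := by
  have hB0 : 0 ≤ B := by simpa using (norm_nonneg _).trans (hB 1 one_ne_zero)
  have hs : Summable (fourierCoefficient f) := by
    have h1 : Summable fun n : ℤ => B * |1 / (n : ℝ) ^ (r + 2)| :=
      ((Real.summable_one_div_int_pow.2 (by omega)).abs).mul_left B
    refine Summable.of_norm_bounded_eventually h1 ?_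
    filter_upwards [(Set.finite_singleton (0 : ℤ)).compl_mem_cofinite] with n hn
    refine (hB n hn).trans (le_of_eq ?_)
    rw [abs_div, abs_one, abs_pow, mul_one_div]
  have hsum := hasSum_fourierCoefficient hf hper hs x
  have hlim : Filter.Tendsto (fun N : ℕ => fourierSum f N x) Filter.atTop (nhds (f x : ℂ)) :=
    hsum.comp Finset.tendsto_Icc_neg
  have hterm : ∀ n : ℤ, n ≠ 0 →
      ‖fourierCoefficient f n * Complex.exp (Complex.I * n * x)‖ ≤ B / |(n : ℝ)| ^ (r + 2) := by
    intro n hn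
    have := norm_exp_neg_I_mul (-n) x
    push_cast at this
    rw [mul_neg, neg_mul, neg_neg] at this
    rw [norm_mul, this, mul_one]
    exact hB n hn
  have hstep : ∀ N : ℕ, ‖fourierSum f (N + 1) x - fourierSum f N x‖ ≤
      2 * (B / ((N : ℝ) + 1) ^ (r + 2)) := by
    intro N
    -- Passing to degree `N + 1` adds the two frequencies `±(N + 1)`.
    have hset : Finset.Icc (-((N + 1 : ℕ) : ℤ)) ((N + 1 : ℕ) : ℤ) =
        insert (-((N + 1 : ℕ) : ℤ)) (insert ((N + 1 : ℕ) : ℤ) (Finset.Icc (-(N : ℤ)) N)) := by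
      ext k
      simp only [Finset.mem_Icc, Finset.mem_insert]
      omega
    have h1 := hterm (-((N + 1 : ℕ) : ℤ)) (by omega)
    have h2 := hterm ((N + 1 : ℕ) : ℤ) (by omega)
    have h3 : |(((N + 1 : ℕ) : ℤ) : ℝ)| = (N : ℝ) + 1 := by
      rw [Int.cast_natCast, Nat.abs_cast]; push_cast; rfl
    rw [h3] at h2
    rw [Int.cast_neg (R := ℝ), abs_neg, h3] at h1
    rw [fourierSum, hset, Finset.sum_insert (by simp; omega), Finset.sum_insert (by simp),
      ← fourierSum, ← add_assoc, add_sub_cancel_right]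
    exact (norm_add_le _ _).trans (by linarith)
  have htel : ∀ k : ℝ, 1 ≤ k → 1 / k ^ (r + 2) ≤ 2 * (1 / k ^ (r + 1) - 1 / (k + 1) ^ (r + 1)) := by
    intro k hk
    have h0 : 0 < k := by linarith
    have h1 : 1 / (k + 1) ^ (r + 1) ≤ 1 / k ^ (r + 1) * (k / (k + 1)) := by
      have : 1 / k ^ (r + 1) * (k / (k + 1)) = 1 / (k ^ r * (k + 1)) := by
        field_simp
        ring
      rw [this, pow_succ]
      gcongr
      linarith
    have h2 : k / (k + 1) ≤ 1 - 1 / (2 * k) := by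
      rw [div_le_iff₀ (by positivity)]
      field_simp
      linarith
    have h3 : 1 / k ^ (r + 1) * (k / (k + 1)) ≤ 1 / k ^ (r + 1) * (1 - 1 / (2 * k)) := by gcongr
    have h4 : 1 / k ^ (r + 1) * (1 - 1 / (2 * k)) = 1 / k ^ (r + 1) - 1 / k ^ (r + 2) / 2 := by
      field_simp
      ring
    linarith
  have hpart : ∀ j : ℕ, ‖fourierSum f (d + j) x - fourierSum f d x‖ ≤
      4 * B * (1 / ((d : ℝ) + 1) ^ (r + 1) - 1 / (((d + j : ℕ) : ℝ) + 1) ^ (r + 1)) := by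
    intro j
    induction j with
    | zero => simp
    | succ j ih =>
      have h1 := hstep (d + j)
      have h2 := norm_add_le (fourierSum f (d + j + 1) x - fourierSum f (d + j) x)
        (fourierSum f (d + j) x - fourierSum f d x)
      rw [sub_add_sub_cancel] at h2
      have h3 := mul_le_mul_of_nonneg_left
        (htel (((d + j : ℕ) : ℝ) + 1) (by linarith [Nat.cast_nonneg (α := ℝ) (d + j)])) hB0
      rw [mul_one_div] at h3
      rw [← add_assoc, Nat.cast_succ (d + j)]
      linarith
  refine le_of_tendsto ((tendsto_const_nhds.sub hlim).norm) ?_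
  filter_upwards [Filter.eventually_ge_atTop d] with N hN
  obtain ⟨j, rfl⟩ := Nat.exists_eq_add_of_le hN
  rw [norm_sub_rev]
  refine (hpart j).trans ?_
  rw [← mul_one_div (4 * B)]
  gcongr
  linarith [show 0 ≤ 1 / (((d + j : ℕ) : ℝ) + 1) ^ (r + 1) by positivity]

/-! ### A lower bound for Jackson constants -/

theorem fourierCoefficient_cos_eq_zero {N : ℕ} {m : ℤ} (h₁ : -(N : ℤ) < m) (h₂ : m < N) :
    fourierCoefficient (fun t => Real.cos (N * t)) m = 0 := by
  have h : ∀ t : ℝ, ((Real.cos (N * t) : ℝ) : ℂ) * Complex.exp (-(Complex.I * m * t)) =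
      1 / 2 * Complex.exp (-(Complex.I * (m - N : ℤ) * t)) +
        1 / 2 * Complex.exp (-(Complex.I * (m + N : ℤ) * t)) := by
    intro t
    have e1 : -(Complex.I * (m - N : ℤ) * t) =
        (N * t : ℂ) * Complex.I + -(Complex.I * m * t) := by push_cast; ring
    have e2 : -(Complex.I * (m + N : ℤ) * t) =
        -(N * t : ℂ) * Complex.I + -(Complex.I * m * t) := by push_cast; ring
    rw [e1, e2, Complex.exp_add, Complex.exp_add]
    push_cast
    rw [Complex.cos]
    ring
  simp only [fourierCoefficient, h]
  rw [intervalIntegral.integral_add (Continuous.intervalIntegrable (by fun_prop) _ _)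
    (Continuous.intervalIntegrable (by fun_prop) _ _), intervalIntegral.integral_const_mul,
    intervalIntegral.integral_const_mul, integral_exp_neg_I_int_mul (by omega),
    integral_exp_neg_I_int_mul (by omega)]
  simp

/-- A lower bound for every constant admissible in Jackson's inequality, from the test function
`cos ((p + 2) x)`, whose Fourier sum of degree `p + 1` vanishes. -/
theorem IsJacksonConstant.exp_neg_one_le {p : ℕ} (hp : 0 < p) {A : ℝ} (hA : IsJacksonConstant p A) :
    Real.exp (-1) ≤ A * Real.log ((p : ℝ) + 1) := by
  have hiter : ∀ k : ℕ, iteratedDeriv k (fun t => Real.cos (((p + 2 : ℕ) : ℝ) * t)) =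
      fun t => ((p + 2 : ℕ) : ℝ) ^ k * iteratedDeriv k Real.cos (((p + 2 : ℕ) : ℝ) * t) := by
    intro k
    rw [iteratedDeriv_comp_const_mul Real.contDiff_cos]
  have hper : Function.Periodic (fun t => Real.cos (((p + 2 : ℕ) : ℝ) * t)) (2 * Real.pi) := by
    intro t
    change Real.cos _ = Real.cos _
    rw [mul_add, Real.cos_add_nat_mul_two_pi]
  have hsmooth : ContDiff ℝ (p + 1 : ℕ) (fun t => Real.cos (((p + 2 : ℕ) : ℝ) * t)) :=
    Real.contDiff_cos.comp (contDiff_const.mul contDiff_id)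
  have hlip : ∀ x y : ℝ, |iteratedDeriv p (fun t => Real.cos (((p + 2 : ℕ) : ℝ) * t)) x -
      iteratedDeriv p (fun t => Real.cos (((p + 2 : ℕ) : ℝ) * t)) y| ≤
        ((p + 2 : ℕ) : ℝ) ^ (p + 1) * |x - y| := by
    intro x y
    have := Convex.norm_image_sub_le_of_norm_deriv_le
      (f := iteratedDeriv p (fun t => Real.cos (((p + 2 : ℕ) : ℝ) * t)))
      (C := ((p + 2 : ℕ) : ℝ) ^ (p + 1)) (s := Set.univ) (x := y) (y := x)
      (fun t _ => (hsmooth.differentiable_iteratedDeriv p (by exact_mod_cast p.lt_succ_self)) t)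
      (fun t _ => ?_) convex_univ (Set.mem_univ _) (Set.mem_univ _)
    · simpa only [Real.norm_eq_abs] using this
    · rw [← iteratedDeriv_succ, hiter, norm_mul, norm_pow, Real.norm_natCast]
      exact mul_le_of_le_one_right (by positivity) (Real.abs_iteratedDeriv_cos_le_one _ _)
  have key := hA _ _ hper (hsmooth.of_le (by exact_mod_cast p.le_succ)) hlip (p + 1) (by omega) 0
  have hzero : fourierSum (fun t => Real.cos (((p + 2 : ℕ) : ℝ) * t)) (p + 1) 0 = 0 := by
    refine Finset.sum_eq_zero fun m hm => ?_
    rw [Finset.mem_Icc] at hm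
    rw [fourierCoefficient_cos_eq_zero (by omega) (by omega), zero_mul]
  rw [hzero, mul_zero, Real.cos_zero, Complex.ofReal_one, zero_sub, norm_neg, norm_one] at key
  push_cast at key
  have hp1 : (0 : ℝ) < (p : ℝ) + 1 := by positivity
  have hpow : ((p : ℝ) + 2) ^ (p + 1) ≤ Real.exp 1 * ((p : ℝ) + 1) ^ (p + 1) := by
    have h1 : ((p : ℝ) + 2) / ((p : ℝ) + 1) ≤ Real.exp (1 / ((p : ℝ) + 1)) := by
      have := Real.add_one_le_exp (1 / ((p : ℝ) + 1))
      have e : ((p : ℝ) + 2) / ((p : ℝ) + 1) = 1 / ((p : ℝ) + 1) + 1 := by field_simp; ring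
      rwa [e]
    have h2 := pow_le_pow_left₀ (by positivity) h1 (p + 1)
    rw [← Real.exp_nat_mul, div_pow, div_le_iff₀ (by positivity)] at h2
    have e : ((p + 1 : ℕ) : ℝ) * (1 / ((p : ℝ) + 1)) = 1 := by push_cast; field_simp
    rwa [e] at h2
  have hAl : 0 ≤ A * Real.log ((p : ℝ) + 1) := by
    by_contra! h
    have : ((p : ℝ) + 2) ^ (p + 1) *
        (A * Real.log ((p : ℝ) + 1) / ((p : ℝ) + 1) ^ (p + 1)) ≤ 0 :=
      mul_nonpos_of_nonneg_of_nonpos (by positivity)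
        (div_nonpos_of_nonpos_of_nonneg h.le (by positivity))
    linarith
  have : 1 ≤ Real.exp 1 * (A * Real.log ((p : ℝ) + 1)) := by
    calc (1 : ℝ) ≤ ((p : ℝ) + 2) ^ (p + 1) *
          (A * Real.log ((p : ℝ) + 1) / ((p : ℝ) + 1) ^ (p + 1)) := key
      _ ≤ (Real.exp 1 * ((p : ℝ) + 1) ^ (p + 1)) *
          (A * Real.log ((p : ℝ) + 1) / ((p : ℝ) + 1) ^ (p + 1)) := by gcongr
      _ = _ := by field_simp
  rw [Real.exp_neg, inv_le_iff_one_le_mul₀ (Real.exp_pos 1), mul_comm]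
  exact this

/-- A crude form of the growth of `√2 ^ p`, by which `log p` is at most logarithmic in
`√2 ^ p / p`. -/
theorem sq_le_eight_mul_sqrt_two_pow (p : ℕ) : (p : ℝ) ^ 2 ≤ 8 * √2 ^ p := by
  have h : p ^ 4 ≤ 64 * 2 ^ p := by
    rcases Nat.lt_or_ge p 6 with h | h
    · interval_cases p <;> norm_num
    · induction p, h using Nat.le_induction with
      | base => norm_num
      | succ p hp ih =>
        have : (p + 1) ^ 4 ≤ 2 * p ^ 4 := by
          obtain ⟨k, rfl⟩ := Nat.exists_eq_add_of_le hp
          ring_nf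
          nlinarith [sq_nonneg k]
        rw [pow_succ 2]
        omega
  have h2 : ((p : ℝ) ^ 2) ^ 2 ≤ (8 * √2 ^ p) ^ 2 := by
    rw [mul_pow, ← pow_mul √2, mul_comm p 2, pow_mul √2, Real.sq_sqrt (by norm_num), ← pow_mul]
    norm_num
    exact_mod_cast h
  exact (pow_le_pow_iff_left₀ (by positivity) (by positivity) two_ne_zero).1 h2

/-! ### Soft bounds -/

theorem softO_mono {C : ℝ} (hC : 0 ≤ C) (k : ℕ) {X Y : ℝ} (hX : 0 ≤ X) (h : X ≤ Y) :
    softO C k X ≤ softO C k Y := by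
  have h1 : Real.log (1 + X) ≤ Real.log (1 + Y) := Real.log_le_log (by linarith) (by linarith)
  have h2 : 0 ≤ Real.log (1 + X) := Real.log_nonneg (by linarith)
  unfold softO
  have hY : 0 ≤ Y := hX.trans h
  gcongr

/-- A Jackson constant can only be smaller than `1` by a factor of order `log (p + 1)`, and this
is absorbed by the logarithm in `softO` because `X` is at least of order `√2 ^ p`. -/
theorem two_mul_le_softO_jackson {p : ℕ} (hp : 0 < p) {A X : ℝ} (hA : IsJacksonConstant p A)
    (hX : √2 ^ p / (2 * Real.pi) ≤ X) : 2 * X ≤ softO 48 1 (A * X) := by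
  have hp' : (1 : ℝ) ≤ p := by exact_mod_cast hp
  have hX0 : 0 ≤ X := le_trans (by positivity) hX
  have hl : 0 < Real.log ((p : ℝ) + 1) := Real.log_pos (by linarith)
  have hlp : Real.log ((p : ℝ) + 1) ≤ p := by
    have := Real.log_le_sub_one_of_pos (by linarith : (0 : ℝ) < (p : ℝ) + 1)
    linarith
  have he := Real.exp_one_lt_d9
  have hepos := Real.exp_pos 1
  set l := Real.log ((p : ℝ) + 1) with hldef
  -- `Y` is the least value of `A * X` allowed by the lower bound for `A`.
  set Y := X / (Real.exp 1 * l) with hY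
  have hY0 : 0 ≤ Y := by positivity
  have hXY : X = Real.exp 1 * l * Y := by rw [hY]; field_simp
  have hYA : Y ≤ A * X := by
    have h1 := hA.exp_neg_one_le hp
    rw [Real.exp_neg, inv_le_iff_one_le_mul₀ hepos] at h1
    rw [hY, div_le_iff₀ (by positivity)]
    calc X = 1 * X := (one_mul X).symm
      _ ≤ (A * l * Real.exp 1) * X := by gcongr
      _ = _ := by ring
  have hpY : (p : ℝ) ≤ 255 * Y := by
    have h1 := sq_le_eight_mul_sqrt_two_pow p
    rw [div_le_iff₀ (by positivity)] at hX
    have h2 : (p : ℝ) * p ≤ p * (255 * Y) := by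
      calc (p : ℝ) * p ≤ 8 * √2 ^ p := by rw [← sq]; exact h1
        _ ≤ 8 * (X * (2 * Real.pi)) := by gcongr
        _ = 16 * (Real.pi * Real.exp 1) * l * Y := by rw [hXY]; ring
        _ ≤ 16 * (3.15 * 2.72) * p * Y := by
          gcongr
          · exact Real.pi_lt_d2.le
          · linarith
        _ ≤ p * (255 * Y) := by
          have : 0 ≤ (p : ℝ) * Y := by positivity
          nlinarith
    exact le_of_mul_le_mul_left h2 (by linarith)
  -- `p + 1 ≤ 2 ^ 8 * (1 + Y)`, and `8 * log 2 ≤ 8`.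
  have hlog : l ≤ 8 * (1 + Real.log (1 + Y)) := by
    have h0 : 0 ≤ Real.log (1 + Y) := Real.log_nonneg (by linarith)
    have h1 : l ≤ Real.log (2 ^ 8 * (1 + Y)) :=
      Real.log_le_log (by linarith) (by norm_num; linarith)
    rw [Real.log_mul (by norm_num) (by linarith), Real.log_pow] at h1
    have := Real.log_two_lt_d9
    push_cast at h1
    linarith
  refine le_trans ?_ (softO_mono (by norm_num) 1 hY0 hYA)
  rw [softO, pow_one]
  have h0 : 0 ≤ Real.log (1 + Y) := Real.log_nonneg (by linarith)
  calc 2 * X = 2 * Real.exp 1 * l * Y := by rw [hXY]; ring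
    _ ≤ 2 * 3 * (8 * (1 + Real.log (1 + Y))) * Y := by
      gcongr
      linarith
    _ = _ := by ring

/-! ### Laurent polynomials and the degree of approximation -/

theorem exists_laurent_eq_fourierSum (f : ℝ → ℝ) (d : ℕ) :
    ∃ P : LaurentPolynomial ℂ, LaurentDegreeLE P d ∧
      ∀ x : ℝ, laurentEval P (Circle.exp x) = fourierSum f d x := by
  refine ⟨∑ n ∈ Finset.Icc (-(d : ℤ)) d,
    LaurentPolynomial.C (fourierCoefficient f n) * LaurentPolynomial.T n, ?_, ?_⟩
  · intro n hn
    rw [AddMonoidAlgebra.coeff_sum, Finsupp.finsetSum_apply]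
    refine Finset.sum_eq_zero fun m hm => ?_
    rw [Finset.mem_Icc] at hm
    rw [← LaurentPolynomial.single_eq_C_mul_T, AddMonoidAlgebra.coeff_single,
      Finsupp.single_eq_of_ne (by omega)]
  · intro x
    rw [laurentEval, map_sum, fourierSum]
    refine Finset.sum_congr rfl fun n _ => ?_
    rw [LaurentPolynomial.eval₂_C_mul_T, RingHom.id_apply, Units.val_zpow_eq_zpow_val,
      Circle.toUnits_apply, Units.val_mk0, Circle.coe_exp, ← Complex.exp_int_mul]
    congr 2
    ring

/-- Degree `2 X` suffices: with `p = q + 1`, the coefficient bound turns into the error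
`(2 / π) * 2 ^ (p + 1) * rectHeight δ p / (d + 1) ^ (p + 1)`, and the heights are
`(√2 ^ p / δ) ^ (p + 1)`. -/
theorem norm_fourierSum_phaseFun_sub_le (hδ : 0 < δ) (hδπ : δ < Real.pi) (q : ℕ) {ε : ℝ}
    (hε : 0 < ε) {d : ℕ}
    (hd : 2 * (√2 ^ (q + 1) / δ * (1 / ε) ^ (1 / (((q + 1 : ℕ) : ℝ) + 1))) ≤ (d : ℝ) + 1) (x : ℝ) :
    ‖fourierSum (phaseFun δ (q + 1)) d x - phaseFun δ (q + 1) x‖ ≤ ε := by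
  have hcont : Continuous (phaseFun δ (q + 1)) := (contDiff_phaseFun hδ hδπ q).continuous
  refine (norm_fourierSum_sub_le hcont (periodic_phaseFun hδ hδπ q) (q + 1)
    (fun n hn => norm_fourierCoefficient_phaseFun_le hδ hδπ q hn) d x).trans ?_
  have hroot : ((1 / ε) ^ (1 / (((q + 1 : ℕ) : ℝ) + 1))) ^ (q + 2) = 1 / ε := by
    have e : 1 / (((q + 1 : ℕ) : ℝ) + 1) = ((q + 2 : ℕ) : ℝ)⁻¹ := by push_cast; ring
    rw [e, Real.rpow_inv_natCast_pow (by positivity) (by omega)]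
  have hpow := pow_le_pow_left₀ (by positivity) hd (q + 2)
  rw [mul_pow, mul_pow, div_pow, hroot, ← pow_mul, ← rectHeight_eq_sqrt_two_pow hδ (q + 1)] at hpow
  have hh := rectHeight_pos hδ (q + 1)
  rw [div_le_iff₀ (by positivity)]
  calc 4 * (2 ^ (q + 2) * rectHeight δ (q + 1) / (2 * Real.pi))
      = 2 ^ (q + 2) * rectHeight δ (q + 1) * (2 / Real.pi) := by field_simp; ring
    _ ≤ 2 ^ (q + 2) * rectHeight δ (q + 1) * 1 := by
      gcongr
      rw [div_le_one Real.pi_pos]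
      exact Real.two_le_pi
    _ = ε * (2 ^ (q + 2) * (rectHeight δ (q + 1) * (1 / ε))) := by field_simp
    _ ≤ _ := by gcongr

end PhaseExtraction

theorem mainTheorem2 :
    ∃ (C : ℝ) (k : ℕ), 0 < C ∧
      ∀ (p : ℕ), 0 < p → ∀ (δ : ℝ), 0 < δ → δ < Real.pi →
        (Function.Periodic (PhaseExtraction.phaseFun δ p) (2 * Real.pi) ∧
          ContDiff ℝ p (PhaseExtraction.phaseFun δ p) ∧
          (∀ x ∈ Set.Ioo (-Real.pi + δ) (Real.pi - δ),
            PhaseExtraction.phaseFun δ p x = x / Real.pi) ∧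
          (∀ x y : ℝ,
            |iteratedDeriv p (PhaseExtraction.phaseFun δ p) x -
                iteratedDeriv p (PhaseExtraction.phaseFun δ p) y| ≤
              Real.sqrt 2 ^ (p * (p + 1)) / δ ^ (p + 1) * |x - y|) ∧
          (∀ x : ℝ,
            PhaseExtraction.circleFun δ p (Circle.exp x) = PhaseExtraction.phaseFun δ p x)) ∧
        ∀ (ε : ℝ), 0 < ε →
          ∃ (d : ℕ) (P : LaurentPolynomial ℂ),
            PhaseExtraction.LaurentDegreeLE P d ∧
            (∀ z : Circle,
              ‖PhaseExtraction.laurentEval P z - (PhaseExtraction.circleFun δ p z : ℂ)‖ ≤ ε) ∧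
            (d : ℝ) ≤ PhaseExtraction.softO C k
              (Real.sqrt 2 ^ p / δ * (1 / ε) ^ (1 / ((p : ℝ) + 1))) ∧
            ∀ A : ℝ, PhaseExtraction.IsJacksonConstant p A →
              (d : ℝ) ≤ PhaseExtraction.softO C k
                (A * Real.sqrt 2 ^ p / δ * (1 / ε) ^ (1 / ((p : ℝ) + 1))) := by
  -- The constant is `48 = 2 * 3 * 8`, from `e < 3` and the factor `8` lost to the Jackson constant.
  open PhaseExtraction in
  refine ⟨48, 1, by norm_num, fun p hp δ hδ hδπ => ?_⟩
  obtain ⟨q, rfl⟩ : ∃ q, p = q + 1 := ⟨p - 1, by omega⟩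
  refine ⟨⟨periodic_phaseFun hδ hδπ q, contDiff_phaseFun hδ hδπ q,
    fun x hx => phaseFun_eq_div_pi hδ hδπ q hx, fun x y => ?_, circleFun_exp hδ hδπ q⟩,
    fun ε hε => ?_⟩
  · rw [← rectHeight_eq_sqrt_two_pow hδ]
    exact abs_iteratedDeriv_phaseFun_sub_le hδ hδπ q x y
  set X := √2 ^ (q + 1) / δ * (1 / ε) ^ (1 / (((q + 1 : ℕ) : ℝ) + 1)) with hX
  have hX0 : 0 ≤ X := by positivity
  have hAX : ∀ A : ℝ, A * √2 ^ (q + 1) / δ * (1 / ε) ^ (1 / (((q + 1 : ℕ) : ℝ) + 1)) = A * X :=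
    fun A => by rw [hX]; ring
  simp only [hAX]
  rcases le_or_gt 2 ε with h2 | h2
  · -- The function is bounded by `2`, so the zero polynomial will do.
    have hA0 : ∀ A : ℝ, IsJacksonConstant (q + 1) A → 0 ≤ A := by
      intro A hA
      have h := (Real.exp_pos _).trans_le (hA.exp_neg_one_le hp)
      exact (pos_of_mul_pos_left h
        (Real.log_nonneg (by linarith [Nat.cast_nonneg (α := ℝ) (q + 1)]))).le
    have hs : ∀ Y : ℝ, 0 ≤ Y → ((0 : ℕ) : ℝ) ≤ softO 48 1 Y := by
      intro Y hY
      have h := softO_mono (by norm_num : (0 : ℝ) ≤ 48) 1 le_rfl hY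
      simpa [softO] using h
    refine ⟨0, 0, fun n _ => rfl, fun z => ?_, hs X hX0,
      fun A hA => hs _ (mul_nonneg (hA0 A hA) hX0)⟩
    rw [laurentEval, map_zero, zero_sub, norm_neg, Complex.norm_real]
    exact (abs_phaseFun_le_two hδ hδπ q _).trans h2
  · -- Here `X` is at least `√2 ^ p / (2 π)`, as the absorption of the Jackson constant requires.
    have hdX : ((⌊2 * X⌋₊ : ℕ) : ℝ) ≤ 2 * X := Nat.floor_le (by positivity)
    obtain ⟨P, hP, hPe⟩ := exists_laurent_eq_fourierSum (phaseFun δ (q + 1)) ⌊2 * X⌋₊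
    refine ⟨⌊2 * X⌋₊, P, hP, fun z => ?_, hdX.trans ?_, fun A hA =>
      hdX.trans (two_mul_le_softO_jackson hp hA ?_)⟩
    · obtain ⟨x, rfl⟩ : ∃ x : ℝ, z = Circle.exp x := ⟨_, (Circle.exp_arg z).symm⟩
      rw [hPe, circleFun_exp hδ hδπ]
      exact norm_fourierSum_phaseFun_sub_le hδ hδπ q hε (Nat.lt_floor_add_one _).le x
    · have h0 : 0 ≤ Real.log (1 + X) := Real.log_nonneg (by linarith)
      rw [softO, pow_one]
      nlinarith [mul_nonneg hX0 h0]
    · have h3 : (1 / 2 : ℝ) ≤ (1 / ε) ^ (1 / (((q + 1 : ℕ) : ℝ) + 1)) := by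
        have hle : 1 / (((q + 1 : ℕ) : ℝ) + 1) ≤ 1 := by
          rw [div_le_one (by positivity)]
          linarith [Nat.cast_nonneg (α := ℝ) (q + 1)]
        calc (1 / 2 : ℝ) = (1 / 2) ^ (1 : ℝ) := (Real.rpow_one _).symm
          _ ≤ (1 / 2) ^ (1 / (((q + 1 : ℕ) : ℝ) + 1)) :=
            Real.rpow_le_rpow_of_exponent_ge (by norm_num) (by norm_num) hle
          _ ≤ _ := by gcongr
      calc √2 ^ (q + 1) / (2 * Real.pi) = √2 ^ (q + 1) / Real.pi * (1 / 2) := by field_simp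
        _ ≤ X := by rw [hX]; gcongr
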